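/- **Notation.** Let $F$ be the free group on $x,y$, let $\Gamma=\mathrm{Aut}\,F$ (automorphisms composed from right to left), and let $\mathrm{Int}\,F\subset\Gamma$ be the subgroup of inner automorphisms. For a normal subgroup $K\subset F$ of finite index put $$\Gamma[K]=\{\sigma\in\Gamma:\ \sigma(K)=K\text{ and }\sigma\text{ acts trivially on }F/K\}.$$ Let $\theta:\Gamma\to\mathrm{Aut}(F/[F,F])=GL_2(\mathbb Z)$ be the canonical homomorphism, let $SL_2'(\mathbb Z)\subset SL_2(\mathbb Z)$ be the subgroup generated by $\begin{pmatrix}1&2\\0&1\end{pmatrix}$ and $\begin{pmatrix}1&0\\2&1\end{pmatrix}$, and let $\mathrm{Aut}'F=\theta^{-1}(SL_2'(\mathbb Z))$. For a group $H$ and $k\ge 1$ let $H^k[H,H]$ be the subgroup generated by the $k$-th powers and the commutators of elements of $H$. **Construction.** Let $N\subset\Gamma$ be a subgroup and $p,q$ primes. Let $\Phi$ be the free group on $a,b$ and let $\nu_0:\Phi\to\Gamma$ send $a$ to $\alpha:(x\mapsto x,\ y\mapsto yx^2)$ and $b$ to $\beta:(x\mapsto xy^2,\ y\mapsto y)$.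 Put $$\mathcal N=\nu_0^{-1}(N),\qquad \mathcal M=\mathcal N^p[\mathcal N,\mathcal N].$$ Let $\Psi=\langle z_1\rangle*\langle z_2\rangle*\langle z_3\rangle$ with each $z_i$ of order $2$. Identify $F$ with a subgroup of $\Psi$ by $x=z_1z_2$, $y=z_2z_3$, and let $F'\subset\Psi$ be the subgroup freely generated by $u=z_1z_2z_3$, $v=z_2z_3z_1$, $w=z_3z_1z_2$. Let $\rho:F'\to F(\bar u,\bar w)$ be the homomorphism to the free group on $\bar u,\bar w$ with $u\mapsto\bar u$, $v\mapsto 1$, $w\mapsto\bar w$, and let $\phi:\Phi\to F(\bar u,\bar w)$ be the isomorphism with $a\mapsto(\bar u\bar w)^{-1}$, $b\mapsto\bar u^{-1}$. Define successively $$M=F\cap\rho^{-1}(\phi(\mathcal M)),\qquad S=\bigcap_{g\in F}gMg^{-1},\qquad T=S\cap F^6[F,F],$$ $$U=T^q[T,T],\qquad K=U\cap F^4[F,F].$$ **Theorem.** Let $N$ be a finite-index normal subgroup of $\Gamma$ with $\mathrm{Int}\,F\subset N\subset\mathrm{Aut}'F$, and let $n=[\mathrm{Aut}'F:N]$. Let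 $p,q$ be distinct odd primes, neither dividing $n$, and put $m=n\cdot p^{\,n+1}$. Then the explicitly constructed subgroup $K\subset F$ above is normal in $F$, its index $[F:K]$ divides $144\,m^4\cdot q^{\,36m^4+1}$, and $\Gamma[K]\subset N$. -/

import Mathlib

namespace AutF2

/-- `Γ[K]`: the automorphisms `σ` of `G` with `σ(K) = K` that act trivially on `G/K`. -/
def congruenceSubgroup {G : Type*} [Group G] (K : Subgroup G) : Subgroup (MulAut G) where
  carrier := {σ | K.map σ.toMonoidHom = K ∧ ∀ g : G, ((σ g : G) : G ⧸ K) = (g : G ⧸ K)}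
  one_mem' := by
    refine ⟨?_, fun g => rfl⟩
    exact Subgroup.map_id K
  mul_mem' := by
    rintro σ τ ⟨hσ, hσ'⟩ ⟨hτ, hτ'⟩
    refine ⟨?_, fun g => (hσ' (τ g)).trans (hτ' g)⟩
    have h : (σ * τ).toMonoidHom = σ.toMonoidHom.comp τ.toMonoidHom := rfl
    rw [h, ← Subgroup.map_map, hτ, hσ]
  inv_mem' := by
    rintro σ ⟨hσ, hσ'⟩
    refine ⟨?_, fun g => ?_⟩
    · have h : (σ⁻¹).toMonoidHom.comp σ.toMonoidHom = MonoidHom.id G := by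
        ext g
        exact σ.symm_apply_apply g
      conv_lhs => rw [← hσ]
      rw [Subgroup.map_map, h, Subgroup.map_id]
    · have h := hσ' (σ⁻¹ g)
      rw [MulAut.apply_inv_self] at h
      exact h.symm

/-- `H^k[H,H]`: the subgroup generated by the `k`-th powers of elements of `H` and by the
commutators of elements of `H`. -/
def powComm {G : Type*} [Group G] (k : ℕ) (H : Subgroup G) : Subgroup G :=
  Subgroup.closure ((fun h : G => h ^ k) '' (H : Set G)) ⊔ ⁅H, H⁆

/-- The free group `F` on `x` and `y`. -/
abbrev F : Type := FreeGroup (Fin 2)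

/-- The first free generator of `F`. -/
def x : F := FreeGroup.of 0

/-- The second free generator of `F`. -/
def y : F := FreeGroup.of 1

/-! ### The homomorphism `θ : Aut F → GL₂(ℤ)` and the subgroup `Aut′ F` -/

/-- The abelianization map `F → ℤ²` (exponent sums). -/
def expSum : F →* Multiplicative (Fin 2 → ℤ) :=
  FreeGroup.lift fun i => Multiplicative.ofAdd (Pi.single i 1)

/-- The matrix of the map that `σ` induces on `F^ab = ℤ²`: its `j`-th column is the image of the
`j`-th generator. -/
def abMatrix (σ : MulAut F) : Matrix (Fin 2) (Fin 2) ℤ :=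
  Matrix.of fun i j => (expSum (σ (FreeGroup.of j))).toAdd i

theorem abMatrix_mulVec (σ : MulAut F) (w : F) :
    (abMatrix σ).mulVec (expSum w).toAdd = (expSum (σ w)).toAdd := by
  let f : F →* Multiplicative (Fin 2 → ℤ) :=
    (AddMonoidHom.toMultiplicative (abMatrix σ).mulVecLin.toAddMonoidHom).comp expSum
  have h : f = expSum.comp σ.toMonoidHom := by
    refine FreeGroup.ext_hom _ _ fun j => ?_
    apply Multiplicative.toAdd.injective
    change (abMatrix σ).mulVec (expSum (FreeGroup.of j)).toAdd = (expSum (σ (FreeGroup.of j))).toAdd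
    funext i
    simp [expSum, abMatrix]
  exact congrArg Multiplicative.toAdd (DFunLike.congr_fun h w)

/-- The canonical homomorphism `θ : Aut F → Aut F^ab = GL₂(ℤ)`. -/
def theta : MulAut F →* GL (Fin 2) ℤ :=
  MonoidHom.toHomUnits
    { toFun := abMatrix
      map_one' := by
        ext i j
        simp [abMatrix, expSum, Matrix.one_apply, Pi.single_apply]
      map_mul' := by
        intro σ τ
        ext i j
        have h := congrFun (abMatrix_mulVec σ (τ (FreeGroup.of j))) i
        exact h.symm }

/-- `SL′₂(ℤ)`: the subgroup of `SL₂(ℤ)` generated by the two elementary matrices with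
off-diagonal entry `2`. -/
def SLprime : Subgroup (Matrix.SpecialLinearGroup (Fin 2) ℤ) :=
  Subgroup.closure
    {⟨!![1, 2; 0, 1], by simp [Matrix.det_fin_two]⟩, ⟨!![1, 0; 2, 1], by simp [Matrix.det_fin_two]⟩}

/-- `Aut′ F`: the preimage of `SL′₂(ℤ)` under `θ`. -/
def autPrime : Subgroup (MulAut F) :=
  (SLprime.map (Matrix.SpecialLinearGroup.toGL (n := Fin 2) (R := ℤ))).comap theta

/-- `Int F`: the inner automorphisms. -/
def intF : Subgroup (MulAut F) := (MulAut.conj : F →* MulAut F).range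

/-! ### The homomorphism `ν₀ : Φ → Aut F` -/

/-- The automorphism `x ↦ x`, `y ↦ y x²`. -/
def alpha : MulAut F :=
  MonoidHom.toMulEquiv (FreeGroup.lift ![x, y * x ^ 2]) (FreeGroup.lift ![x, y * (x ^ 2)⁻¹])
    (by
      refine FreeGroup.ext_hom _ _ fun i => ?_
      fin_cases i <;> simp [x, y])
    (by
      refine FreeGroup.ext_hom _ _ fun i => ?_
      fin_cases i <;> simp [x, y])

/-- The automorphism `x ↦ x y²`, `y ↦ y`. -/
def beta : MulAut F :=
  MonoidHom.toMulEquiv (FreeGroup.lift ![x * y ^ 2, y]) (FreeGroup.lift ![x * (y ^ 2)⁻¹, y])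
    (by
      refine FreeGroup.ext_hom _ _ fun i => ?_
      fin_cases i <;> simp [x, y])
    (by
      refine FreeGroup.ext_hom _ _ fun i => ?_
      fin_cases i <;> simp [x, y])

/-- The free group `Φ` on `a` (index `0`) and `b` (index `1`). -/
abbrev Phi : Type := FreeGroup (Fin 2)

/-- `ν₀ : Φ → Aut F`, `a ↦ α`, `b ↦ β`. -/
def nu0 : Phi →* MulAut F := FreeGroup.lift ![alpha, beta]

/-! ### The groups `Ψ ⊇ F, F′` and the map `ρ : F′ → F(ū, w̄)` -/

/-- `Ψ = ⟨z₁⟩ * ⟨z₂⟩ * ⟨z₃⟩`, the free product of three groups of order two. -/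
abbrev Psi : Type := Monoid.CoprodI fun _ : Fin 3 => Multiplicative (ZMod 2)

/-- The involution `z_{i+1}` of `Ψ`, for `i = 0, 1, 2`. -/
def z (i : Fin 3) : Psi := Monoid.CoprodI.of (i := i) (Multiplicative.ofAdd (1 : ZMod 2))

/-- The embedding `F → Ψ`, `x ↦ z₁z₂`, `y ↦ z₂z₃`. -/
def inclF : F →* Psi := FreeGroup.lift ![z 0 * z 1, z 1 * z 2]

/-- The embedding of `F′ = F(u, v, w)` in `Ψ`: `u ↦ z₁z₂z₃`, `v ↦ z₂z₃z₁`, `w ↦ z₃z₁z₂`. -/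
def inclF' : FreeGroup (Fin 3) →* Psi :=
  FreeGroup.lift ![z 0 * z 1 * z 2, z 1 * z 2 * z 0, z 2 * z 0 * z 1]

/-- The free group `F(ū, w̄)`, with `ū` of index `0` and `w̄` of index `1`. -/
abbrev Fbar : Type := FreeGroup (Fin 2)

/-- `ρ : F′ → F(ū, w̄)`, `u ↦ ū`, `v ↦ 1`, `w ↦ w̄`. -/
def rho : FreeGroup (Fin 3) →* Fbar :=
  FreeGroup.lift ![FreeGroup.of 0, 1, FreeGroup.of 1]

/-- The isomorphism `φ : Φ → F(ū, w̄)`, `a ↦ (ūw̄)⁻¹`, `b ↦ ū⁻¹`. The inverses are there because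
automorphisms are composed from right to left and `MulAut.conj g` is `h ↦ g h g⁻¹`: with them, the
action of `r ∈ Φ` on `F(ū, w̄)` is conjugation by `φ r`, that is `h ↦ (φ r) h (φ r)⁻¹`. -/
def phi : Phi →* Fbar :=
  FreeGroup.lift ![(FreeGroup.of 0 * FreeGroup.of 1)⁻¹, (FreeGroup.of 0)⁻¹]

/-! ### The explicit subgroup `K` -/

/-- `𝒩 ⊆ Φ`, the subgroup corresponding to `N / Int F` under `Φ ≅ Aut′ F / Int F`. -/
def scriptN (N : Subgroup (MulAut F)) : Subgroup Phi := N.comap nu0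

/-- `ℳ = 𝒩^p[𝒩,𝒩]`. -/
def scriptM (N : Subgroup (MulAut F)) (p : ℕ) : Subgroup Phi := powComm p (scriptN N)

/-- `M = M′ ∩ F`, where `M′ = ρ⁻¹(φ(ℳ)) ⊆ F′`; the intersection is taken inside `Ψ`. -/
def subgroupM (N : Subgroup (MulAut F)) (p : ℕ) : Subgroup F :=
  ((((scriptM N p).map phi).comap rho).map inclF').comap inclF

/-- `S = ⋂_{g ∈ F} g M g⁻¹`. -/
def subgroupS (N : Subgroup (MulAut F)) (p : ℕ) : Subgroup F := (subgroupM N p).normalCore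

/-- `T = S ∩ F⁶[F,F]`. -/
def subgroupT (N : Subgroup (MulAut F)) (p : ℕ) : Subgroup F := subgroupS N p ⊓ powComm 6 ⊤

/-- `U = T^q[T,T]`. -/
def subgroupU (N : Subgroup (MulAut F)) (p q : ℕ) : Subgroup F := powComm q (subgroupT N p)

/-- `K = U ∩ F⁴[F,F]`. -/
def subgroupK (N : Subgroup (MulAut F)) (p q : ℕ) : Subgroup F := subgroupU N p q ⊓ powComm 4 ⊤

end AutF2

/-! Let σ ∈ Γ[K]. As K ⊂ F⁴[F,F], σ is trivial on F^ab modulo 4, and this forces σ = conj(g)·ν₀(r)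
with g ∈ F, r ∈ Φ (`mem_intNu_of_abMatrix`, resting on Nielsen generators of Aut F). Since Int F ⊂
N, it remains to see that r ∈ 𝒩. The action of r extends to Ψ, preserves F′, and under ρ becomes
conjugation by φ(r) (`rho_nuF'`). If σ were trivial on Ψ/T and g were harmless under ρ, then r would
be central modulo ℳ = 𝒩^p[𝒩,𝒩], and an element central modulo 𝒩^p[𝒩,𝒩] lies in 𝒩
(`mem_of_central_mod_powComm`).

The passage to U = T^q[T,T] supplies both conditions. Write σ(z₂) = d z₂ with d ∈ F. Comparing σ
with its conjugate by z₂ shows that d is central modulo U, so d ∈ T by the same lemma; hence σ is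
trivial on Ψ/T. Moreover ν₀(r) fixes c = [y,x] = v², so g commutes with c modulo U, and therefore g
= c^j t with t ∈ T (`mem_zpowers_of_commute_mod_powComm`). As ρ kills v, the image of g under ρ lies
in φ(ℳ).

Both centralizer lemmas are Fox calculus: a crossed homomorphism from F to the functions F/T → ℤ/q
can be prescribed on x and y, and it vanishes on T^q[T,T]. Summing over a cyclic subgroup of F/T
gives the contradictions, with 1 ≠ -1 in ℤ/q at the end.

The index estimate combines the Schreier bound (`relIndex_powComm_dvd`) with the fact that M ∩
F²[F,F] is normal in F²[F,F], a subgroup of index 4, so that passing to the core costs at most a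
fourth power. -/

namespace AutF2

/-! ### Common prefixes and the length function of a free group -/

section CommonPrefix

variable {β : Type*} [DecidableEq β]

/-- The length of the longest common prefix of two lists. -/
def commonPrefix : List β → List β → ℕ
  | a :: l, b :: m => if a = b then commonPrefix l m + 1 else 0
  | [], _ => 0
  | _ :: _, [] => 0

theorem commonPrefix_comm (l m : List β) : commonPrefix l m = commonPrefix m l := by
  induction l generalizing m with
  | nil => cases m <;> rfl
  | cons a l ih =>
    cases m with
    | nil => rfl
    | cons b m =>
      by_cases h : a = b
      · subst h; simp [commonPrefix, ih]
      · simp [commonPrefix, h, Ne.symm h]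

/-- The ultrametric inequality for Gromov products in a tree. -/
theorem min_commonPrefix_le (l k m : List β) :
    min (commonPrefix l k) (commonPrefix k m) ≤ commonPrefix l m := by
  induction l generalizing k m with
  | nil => simp [commonPrefix]
  | cons a l ih =>
    cases k with
    | nil => simp [commonPrefix]
    | cons b k =>
      cases m with
      | nil => simp [commonPrefix]
      | cons c m =>
        have := ih k m
        simp only [commonPrefix]
        split_ifs <;> first | omega | simp_all

theorem exists_append_of_le_commonPrefix (l m : List β) (n : ℕ) (h : n ≤ commonPrefix l m) :
    ∃ P l' m', l = P ++ l' ∧ m = P ++ m' ∧ P.length = n := by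
  induction l generalizing m n with
  | nil =>
    simp [commonPrefix] at h
    exact ⟨[], [], m, by simp [h]⟩
  | cons a l ih =>
    cases m with
    | nil =>
      simp [commonPrefix] at h
      exact ⟨[], a :: l, [], by simp [h]⟩
    | cons b m =>
      simp only [commonPrefix] at h
      split_ifs at h with hab
      · subst hab
        cases n with
        | zero => exact ⟨[], _, _, rfl, rfl, rfl⟩
        | succ n =>
          obtain ⟨P, l', m', h1, h2, h3⟩ := ih m n (by omega)
          exact ⟨a :: P, l', m', by simp [h1], by simp [h2], by simp [h3]⟩
      · exact ⟨[], _, _, rfl, rfl, by simp; omega⟩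

end CommonPrefix

section Norm

variable {α : Type*} [DecidableEq α]

open FreeGroup

/-- Exactly the common prefix cancels: once it is stripped, the first letters differ and the
concatenation is reduced. -/
theorem norm_mk_inv_mul_mk (l m : List (α × Bool)) (hl : IsReduced l) (hm : IsReduced m) :
    FreeGroup.norm ((mk l)⁻¹ * mk m) + 2 * commonPrefix l m = l.length + m.length := by
  induction l generalizing m with
  | nil =>
    simp only [commonPrefix, ← one_eq_mk, inv_one, one_mul, FreeGroup.norm, toWord_mk, hm.reduce_eq]
    simp
  | cons a l ih =>
    cases m with
    | nil =>
      simp only [commonPrefix, ← one_eq_mk, mul_one, norm_inv_eq]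
      simp only [FreeGroup.norm, toWord_mk, hl.reduce_eq]
      simp
    | cons b m =>
      simp only [commonPrefix]
      split_ifs with hab
      · subst hab
        have h := ih m (hl.infix ⟨[a], [], by simp⟩) (hm.infix ⟨[a], [], by simp⟩)
        have e : (mk (a :: l))⁻¹ * mk (a :: m) = (mk l)⁻¹ * mk m := by
          have h1 : mk (a :: l) = mk [a] * mk l := by simp
          have h2 : mk (a :: m) = mk [a] * mk m := by simp
          rw [h1, h2]; group
        rw [e]
        simp only [List.length_cons]
        omega
      · rw [inv_mk, mul_mk, FreeGroup.norm, toWord_mk, IsReduced.reduce_eq]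
        · simp
        · have h1 : IsReduced (invRev (a :: l)) := by
            rw [isReduced_iff_reduce_eq] at hl ⊢
            rw [reduce_invRev, hl]
          rw [FreeGroup.IsReduced, List.isChain_append]
          refine ⟨h1, hm, ?_⟩
          intro u hu v hv
          simp only [invRev, List.map_cons, List.reverse_cons, List.getLast?_append,
            List.getLast?_singleton, Option.some_or, Option.mem_def, Option.some.injEq,
            List.head?_cons] at hu hv
          subst hu; subst hv
          intro h
          by_contra h'
          apply hab
          obtain ⟨a1, a2⟩ := a
          obtain ⟨b1, b2⟩ := b
          simp only at h h'
          subst h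
          cases a2 <;> cases b2 <;> simp_all

/-- The Gromov product on a free group: the length of the longest common prefix. -/
def gromov (g h : FreeGroup α) : ℕ := commonPrefix g.toWord h.toWord

theorem norm_inv_mul (g h : FreeGroup α) : FreeGroup.norm (g⁻¹ * h) + 2 * gromov g h = FreeGroup.norm g + FreeGroup.norm h := by
  have := norm_mk_inv_mul_mk g.toWord h.toWord isReduced_toWord isReduced_toWord
  rwa [mk_toWord, mk_toWord] at this

theorem gromov_comm (g h : FreeGroup α) : gromov g h = gromov h g := commonPrefix_comm _ _

theorem min_gromov_le (g k h : FreeGroup α) : min (gromov g k) (gromov k h) ≤ gromov g h :=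
  min_commonPrefix_le _ _ _

/-- If g and g⁻¹ shared a prefix P of at least half the length, P⁻¹ would also be a suffix of g. For
even length this gives g = P P⁻¹ = 1; for odd length the middle letter would be its own inverse. -/
theorem gromov_inv_lt (g : FreeGroup α) (hg : g ≠ 1) : 2 * gromov g⁻¹ g < FreeGroup.norm g := by
  by_contra! hle
  obtain ⟨P, l, m, h1, h2, h3⟩ := exists_append_of_le_commonPrefix g⁻¹.toWord g.toWord
    ((FreeGroup.norm g + 1) / 2) (by unfold gromov at hle; omega)
  have hlen : g.toWord.length = FreeGroup.norm g := rfl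
  have hlen' : g⁻¹.toWord.length = FreeGroup.norm g := norm_inv_eq
  have h4 : g.toWord = invRev l ++ invRev P := by
    have : invRev g⁻¹.toWord = invRev l ++ invRev P := by rw [h1]; simp [invRev]
    rw [← this, toWord_inv, invRev_invRev]
  have e1 := congrArg List.length h1
  have e2 := congrArg List.length h2
  rw [List.length_append] at e1 e2
  rcases Nat.even_or_odd' (FreeGroup.norm g) with ⟨k, hk | hk⟩
  · have h5 := h2.symm.trans h4
    obtain ⟨h6, h7⟩ := List.append_inj h5 (by rw [invRev_length]; omega)
    apply hg
    rw [← mk_toWord (x := g), h2, h7, ← mul_mk, ← inv_mk, mul_inv_cancel]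
  · rcases List.eq_nil_or_concat P with hP | ⟨P', c, hP⟩
    · subst hP; simp at h3; omega
    · subst hP
      have h5 := h2.symm.trans h4
      rw [List.concat_eq_append] at *
      simp only [List.length_append, List.length_singleton] at h3
      have h6 : P' ++ (c :: m) = invRev l ++ ((c.1, !c.2) :: invRev P') := by
        simpa [invRev] using h5
      obtain ⟨-, h7⟩ := List.append_inj h6 (by
        rw [invRev_length]
        simp only [List.length_append, List.length_singleton] at e1; omega)
      have h8 := congrArg Prod.snd (List.cons.inj h7).1
      simp at h8

/-- A letter of the alphabet of two generators and their inverses, evaluated at a pair. -/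
def letterVal {G : Type*} [Group G] (f : Fin 2 → G) (a : Fin 2 × Bool) : G :=
  cond a.2 (f a.1) (f a.1)⁻¹

theorem letterVal_flip {G : Type*} [Group G] (f : Fin 2 → G) (a : Fin 2 × Bool) :
    letterVal f (a.1, !a.2) = (letterVal f a)⁻¹ := by
  obtain ⟨i, _ | _⟩ := a <;> simp [letterVal]

/-- If no letter is absorbed by its neighbours, reduced words of length `n` have FreeGroup.norm at
least `n`. -/
theorem length_le_norm_of_no_absorption (f : Fin 2 → FreeGroup α)
    (hf : ∀ a b c : Fin 2 × Bool, a ≠ b → c ≠ (b.1, !b.2) →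
      gromov (letterVal f a) (letterVal f b) + gromov (letterVal f b)⁻¹ (letterVal f c)
        < FreeGroup.norm (letterVal f b))
    (a : Fin 2 × Bool) (L : List (Fin 2 × Bool)) (hL : IsReduced (a :: L)) :
    ∀ b, b ≠ a →
      gromov ((a :: L).map (letterVal f)).prod (letterVal f b)
        = gromov (letterVal f a) (letterVal f b) ∧
      (a :: L).length + gromov (letterVal f a) (letterVal f b)
        ≤ FreeGroup.norm ((a :: L).map (letterVal f)).prod := by
  induction L generalizing a with
  | nil =>
    intro b hb
    have := hf b a (a.1, a.2) hb (by simp [Prod.ext_iff])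
    rw [gromov_comm] at this
    simp
    omega
  | cons a' L ih =>
    intro b hb
    have hne : a' ≠ (a.1, !a.2) := by
      rintro rfl
      have := (isReduced_cons_cons.1 hL).1 rfl
      simp at this
    have hne' : (a.1, !a.2) ≠ a' := hne.symm
    have ih' := ih a' (isReduced_cons_cons.1 hL).2 _ hne'
    rw [letterVal_flip] at ih'
    have key := hf b a a' hb hne
    set g := ((a' :: L).map (letterVal f)).prod with hg
    have hprod : ((a :: a' :: L).map (letterVal f)).prod = letterVal f a * g := by
      rw [List.map_cons, List.prod_cons]
    rw [hprod]
    have n1 := norm_inv_mul (letterVal f a)⁻¹ g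
    rw [inv_inv, norm_inv_eq] at n1
    have n2 := norm_inv_mul (letterVal f a) (letterVal f a * g)
    rw [inv_mul_cancel_left] at n2
    rw [gromov_comm] at ih'
    rw [gromov_comm (letterVal f b)] at key
    rw [gromov_comm (letterVal f a')] at ih'
    -- By `key`, the product retains a longer prefix of its first letter than that letter shares
    -- with b, so the ultrametric inequality makes the two overlaps with b equal.
    have m1 := min_gromov_le (letterVal f a * g) (letterVal f a) (letterVal f b)
    have m2 := min_gromov_le (letterVal f a) (letterVal f a * g) (letterVal f b)
    rw [gromov_comm (letterVal f a * g) (letterVal f a)] at m1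
    simp only [List.length_cons] at ih' ⊢
    constructor <;> omega

end Norm

/-! ### Nielsen reduction of generating pairs -/

open FreeGroup in
/-- A non-empty set of generating pairs of `F` closed under Nielsen moves and simultaneous
conjugation contains the standard basis. -/
theorem standard_pair_of_nielsen_closed (P : F → F → Prop)
    (hgen : ∀ a b, P a b → Function.Surjective (FreeGroup.lift ![a, b]))
    (hne : ∀ a b, P a b → a ≠ 1)
    (hswap : ∀ a b, P a b → P b a) (hinv : ∀ a b, P a b → P a⁻¹ b)
    (hmul : ∀ a b, P a b → P (a * b) b)
    (hconj : ∀ a b g, P a b → P (g * a * g⁻¹) (g * b * g⁻¹))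
    (hP : ∃ a b, P a b) : P x y := by
  have hex : ∃ n a b, P a b ∧ FreeGroup.norm a + FreeGroup.norm b = n := by
    obtain ⟨a, b, h⟩ := hP
    exact ⟨_, a, b, h, rfl⟩
  classical
  obtain ⟨a₀, b₀, h₀, hn₀⟩ := Nat.find_spec hex
  have hmin : ∀ a b, P a b → FreeGroup.norm a₀ + FreeGroup.norm b₀ ≤ FreeGroup.norm a + FreeGroup.norm b := fun a b h => by
    rw [hn₀]; exact Nat.find_min' hex ⟨a, b, h, rfl⟩
  clear hn₀
  set f : Fin 2 → F := ![a₀, b₀] with hf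
  have hinv' : ∀ a b, P a b → P a b⁻¹ := fun a b h => hswap _ _ (hinv _ _ (hswap _ _ h))
  have hPl : ∀ a b : Fin 2 × Bool, a.1 ≠ b.1 → P (letterVal f a) (letterVal f b) ∧
      FreeGroup.norm (letterVal f a) + FreeGroup.norm (letterVal f b) = FreeGroup.norm a₀ + FreeGroup.norm b₀ := by
    rintro ⟨i, s⟩ ⟨j, t⟩ hij
    fin_cases i <;> fin_cases j
    · simp at hij
    · cases s <;> cases t <;> simp [letterVal, hf, h₀, hinv, hinv']
    · have h₁ := hswap _ _ h₀
      cases s <;> cases t <;> simp [letterVal, hf, h₁, hinv, hinv', add_comm]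
    · simp at hij
  have hother : ∀ a : Fin 2 × Bool, ∃ b : Fin 2 × Bool, a.1 ≠ b.1 := by
    rintro ⟨i, s⟩
    exact ⟨(1 - i, true), by fin_cases i <;> simp⟩
  have hl1 : ∀ a, letterVal f a ≠ 1 := fun a => by
    obtain ⟨b, hb⟩ := hother a
    exact hne _ _ (hPl a b hb).1
  have hlmul : ∀ a b, P a b → P (b⁻¹ * a) b := fun a b h => by
    have := hinv _ _ (hmul _ _ (hinv _ _ h))
    simpa using this
  -- Otherwise replacing a by b⁻¹a would shorten the minimal pair.
  have h2 : ∀ a b : Fin 2 × Bool, a.1 ≠ b.1 →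
      2 * gromov (letterVal f a) (letterVal f b) ≤ FreeGroup.norm (letterVal f b) := fun a b hab => by
    obtain ⟨h3, h4⟩ := hPl a b hab
    have h5 := hmin _ _ (hlmul _ _ h3)
    have h6 := norm_inv_mul (letterVal f b) (letterVal f a)
    rw [gromov_comm] at h6
    omega
  -- The degenerate case: b is half absorbed by a at both ends, so b = A B⁻¹ and a = A R B⁻¹.
  -- Conjugating the pair (b⁻¹a, b) by B⁻¹ gives (R, B⁻¹A), shorter by |b|. Closure under
  -- conjugation thus replaces the usual well-ordering of half-words.
  have h3 : ∀ a b : Fin 2 × Bool, a.1 ≠ b.1 →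
      2 * gromov (letterVal f a) (letterVal f b) = FreeGroup.norm (letterVal f b) →
      2 * gromov (letterVal f a)⁻¹ (letterVal f b)⁻¹ = FreeGroup.norm (letterVal f b) → False := by
    intro a b hab e1 e2
    have hle := h2 b a (Ne.symm hab)
    rw [gromov_comm] at hle
    obtain ⟨hPab, hnorm⟩ := hPl a b hab
    have hb1 := hl1 b
    generalize letterVal f a = g at *
    generalize letterVal f b = h at *
    obtain ⟨A, l, m, w1, w2, w3⟩ := exists_append_of_le_commonPrefix g.toWord h.toWord _ le_rfl
    obtain ⟨B, l', m', w1', w2', w3'⟩ :=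
      exists_append_of_le_commonPrefix g⁻¹.toWord h⁻¹.toWord _ le_rfl
    change _ = gromov _ _ at w3 w3'
    have r1 : g.toWord = invRev l' ++ invRev B := by
      rw [← invRev_invRev (L₁ := g.toWord), ← toWord_inv, w1']; simp [invRev]
    have r2 : h.toWord = invRev m' ++ invRev B := by
      rw [← invRev_invRev (L₁ := h.toWord), ← toWord_inv, w2']; simp [invRev]
    have lh : h.toWord.length = FreeGroup.norm h := rfl
    have lg : g.toWord.length = FreeGroup.norm g := rfl
    obtain ⟨-, hm⟩ := List.append_inj' (w2.symm.trans r2) (by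
      have := congrArg List.length w2
      rw [List.length_append] at this
      rw [invRev_length]; omega)
    have lB : (invRev B).length = B.length := invRev_length
    obtain ⟨R, hR⟩ : ∃ R, l = R ++ invRev B := by
      have h9 := w1.symm.trans r1
      have h10 : A.length ≤ (invRev l').length := by
        have := congrArg List.length r1
        rw [List.length_append] at this
        omega
      rcases List.append_eq_append_iff.1 h9 with ⟨R, q1, q2⟩ | ⟨R, q1, q2⟩
      · exact ⟨R, q2⟩
      · refine ⟨[], ?_⟩
        have : R = [] := by
          rw [q1, List.length_append] at h10
          exact List.length_eq_zero_iff.1 (by omega)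
        subst this
        simpa using q2.symm
    have eg : g = mk A * mk R * mk (invRev B) := by
      rw [← mk_toWord (x := g), w1, hR]; simp
    have eh : h = mk A * mk (invRev B) := by
      rw [← mk_toWord (x := h), w2, hm]; simp
    have hPn := hconj _ _ (mk (invRev B)) (hlmul _ _ hPab)
    have q1 : mk (invRev B) * (h⁻¹ * g) * (mk (invRev B))⁻¹ = mk R := by
      rw [eg, eh]; group
    have q2 : mk (invRev B) * h * (mk (invRev B))⁻¹ = mk (invRev B ++ A) := by
      rw [eh, ← mul_mk]; group
    rw [q1, q2] at hPn
    have hfin := hmin _ _ hPn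
    have n1 : FreeGroup.norm (mk R) ≤ R.length := norm_mk_le
    have n2 : FreeGroup.norm (mk (invRev B ++ A)) ≤ (invRev B ++ A).length := norm_mk_le
    rw [List.length_append] at n2
    have n3 := congrArg List.length w1
    rw [hR, List.length_append, List.length_append] at n3
    have : FreeGroup.norm h ≠ 0 := fun h0 => hb1 (norm_eq_zero.1 h0)
    omega
  have hN : ∀ a b c : Fin 2 × Bool, a ≠ b → c ≠ (b.1, !b.2) →
      gromov (letterVal f a) (letterVal f b) + gromov (letterVal f b)⁻¹ (letterVal f c)
        < FreeGroup.norm (letterVal f b) := by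
    intro a b c hab hcb
    have flip : ∀ u v : Fin 2 × Bool, u.1 = v.1 → u ≠ v → u = (v.1, !v.2) := by
      rintro ⟨u1, u2⟩ ⟨v1, v2⟩ h h'
      simp only at h; subst h
      cases u2 <;> cases v2 <;> simp_all
    have hself := gromov_inv_lt _ (hl1 b)
    have hL : 2 * gromov (letterVal f a) (letterVal f b) ≤ FreeGroup.norm (letterVal f b) := by
      by_cases h : a.1 = b.1
      · rw [flip a b h hab, letterVal_flip]; omega
      · exact h2 a b h
    have hR : 2 * gromov (letterVal f b)⁻¹ (letterVal f c) ≤ FreeGroup.norm (letterVal f b) := by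
      by_cases h : c.1 = b.1
      · have : c = b := by
          by_contra h'
          exact hcb (flip c b h h')
        rw [this]; omega
      · rw [gromov_comm, ← letterVal_flip, ← norm_inv_eq (x := letterVal f b), ← letterVal_flip]
        exact h2 c (b.1, !b.2) h
    by_cases ha : a.1 = b.1
    · rw [flip a b ha hab, letterVal_flip] at hL ⊢; omega
    by_cases hc : c.1 = b.1
    · have : c = b := by
        by_contra h'
        exact hcb (flip c b hc h')
      rw [this] at hR ⊢; omega
    by_contra hcon
    have q1 : 2 * gromov (letterVal f a) (letterVal f b) = FreeGroup.norm (letterVal f b) := by omega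
    have q2 : 2 * gromov (letterVal f b)⁻¹ (letterVal f c) = FreeGroup.norm (letterVal f b) := by omega
    -- Both overlaps are now exactly half of b. If a = c, then b and b⁻¹ share half of b through a,
    -- against `gromov_inv_lt`; otherwise c is the inverse of a and `h3` applies.
    by_cases hac : a = c
    · subst hac
      have := min_gromov_le (letterVal f b)⁻¹ (letterVal f a) (letterVal f b)
      omega
    · have hac1 : c.1 = a.1 := by
        have := a.1.isLt; have := b.1.isLt; have := c.1.isLt
        have h1 : (a.1 : ℕ) ≠ b.1 := fun h => ha (Fin.ext h)
        have h2 : (c.1 : ℕ) ≠ b.1 := fun h => hc (Fin.ext h)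
        exact Fin.ext (by omega)
      rw [flip c a hac1 (Ne.symm hac), letterVal_flip, gromov_comm] at q2
      exact h3 a b ha q1 q2
  have hgen' : ∀ g : F, FreeGroup.norm g = 1 → ∃ a, letterVal f a = g := by
    intro g hg
    obtain ⟨w, hw⟩ := hgen _ _ h₀ g
    have hw' : g = (w.toWord.map (letterVal f)).prod := by
      rw [← hw]
      conv_lhs => rw [← mk_toWord (x := w)]
      rw [FreeGroup.lift_mk]; rfl
    have hred : IsReduced w.toWord := isReduced_toWord
    cases hword : w.toWord with
    | nil => rw [hword] at hw'; subst hw'; simp at hg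
    | cons a L =>
      rw [hword] at hw' hred
      have := (length_le_norm_of_no_absorption f hN a L hred (a.1, !a.2)
        (by simp [Prod.ext_iff])).2
      rw [← hw', hg, List.length_cons] at this
      have hL : L = [] := List.length_eq_zero_iff.1 (by omega)
      subst hL
      exact ⟨a, by simpa using hw'.symm⟩
  obtain ⟨a, ha⟩ := hgen' x (norm_of _)
  obtain ⟨b, hb⟩ := hgen' y (norm_of _)
  have hab : a.1 ≠ b.1 := by
    intro h
    obtain ⟨i, s⟩ := a
    obtain ⟨j, t⟩ := b
    simp only at h; subst h
    have hxy : x = y ∨ x = y⁻¹ := by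
      rw [← ha, ← hb]
      cases s <;> cases t <;> simp [letterVal]
    revert hxy
    simp only [x, y]
    decide
  have := (hPl a b hab).1
  rwa [ha, hb] at this

/-! ### Nielsen generators of `Aut F` -/

theorem mulAut_ext {σ τ : MulAut F} (hx : σ x = τ x) (hy : σ y = τ y) : σ = τ := by
  have : σ.toMonoidHom = τ.toMonoidHom := by
    refine FreeGroup.ext_hom _ _ fun i => ?_
    fin_cases i
    · exact hx
    · exact hy
  ext g
  exact DFunLike.congr_fun this g

@[simp] theorem alpha_x : alpha x = x := by simp [alpha, x]
@[simp] theorem alpha_y : alpha y = y * x ^ 2 := by simp [alpha, y]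
@[simp] theorem beta_x : beta x = x * y ^ 2 := by simp [beta, x]
@[simp] theorem beta_y : beta y = y := by simp [beta, y]
@[simp] theorem alpha_symm_x : alpha.symm x = x := by
  rw [MulEquiv.symm_apply_eq, alpha_x]
@[simp] theorem alpha_symm_y : alpha.symm y = y * (x ^ 2)⁻¹ := by
  rw [MulEquiv.symm_apply_eq]; simp
@[simp] theorem beta_symm_x : beta.symm x = x * (y ^ 2)⁻¹ := by
  rw [MulEquiv.symm_apply_eq]; simp
@[simp] theorem beta_symm_y : beta.symm y = y := by
  rw [MulEquiv.symm_apply_eq, beta_y]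

/-- The automorphism exchanging `x` and `y`. -/
def swapAut : MulAut F :=
  MonoidHom.toMulEquiv (FreeGroup.lift ![y, x]) (FreeGroup.lift ![y, x])
    (by
      refine FreeGroup.ext_hom _ _ fun i => ?_
      fin_cases i <;> simp [x, y])
    (by
      refine FreeGroup.ext_hom _ _ fun i => ?_
      fin_cases i <;> simp [x, y])

@[simp] theorem swapAut_x : swapAut x = y := by simp [swapAut, x]
@[simp] theorem swapAut_y : swapAut y = x := by simp [swapAut, y]

/-- The automorphism `x ↦ x y`, `y ↦ y`. -/
def transvAut : MulAut F :=
  MonoidHom.toMulEquiv (FreeGroup.lift ![x * y, y]) (FreeGroup.lift ![x * y⁻¹, y])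
    (by
      refine FreeGroup.ext_hom _ _ fun i => ?_
      fin_cases i <;> simp [x, y])
    (by
      refine FreeGroup.ext_hom _ _ fun i => ?_
      fin_cases i <;> simp [x, y])

@[simp] theorem transvAut_x : transvAut x = x * y := by simp [transvAut, x]
@[simp] theorem transvAut_y : transvAut y = y := by simp [transvAut, y]

/-- The automorphisms raising each generator to the power `±1`. -/
def signAut : (Fin 2 → ℤˣ) →* MulAut F where
  toFun s := MonoidHom.toMulEquiv (FreeGroup.lift fun i => FreeGroup.of i ^ (s i : ℤ))
    (FreeGroup.lift fun i => FreeGroup.of i ^ (s i : ℤ))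
    (by
      refine FreeGroup.ext_hom _ _ fun i => ?_
      rcases Int.units_eq_one_or (s i) with h | h <;> simp [h])
    (by
      refine FreeGroup.ext_hom _ _ fun i => ?_
      rcases Int.units_eq_one_or (s i) with h | h <;> simp [h])
  map_one' := by
    refine mulAut_ext ?_ ?_ <;> simp [x, y]
  map_mul' s t := by
    refine mulAut_ext ?_ ?_ <;>
      simp [x, y, zpow_mul]

theorem signAut_x (s : Fin 2 → ℤˣ) : signAut s x = x ^ (s 0 : ℤ) := by simp [signAut, x]
theorem signAut_y (s : Fin 2 → ℤˣ) : signAut s y = y ^ (s 1 : ℤ) := by simp [signAut, y]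

/-- A subgroup of `Aut F` containing the inner automorphisms and the Nielsen moves is everything. -/
theorem eq_top_of_nielsen_mem (H : Subgroup (MulAut F)) (hInt : intF ≤ H) (hs : swapAut ∈ H)
    (hi : signAut ![-1, 1] ∈ H) (ht : transvAut ∈ H) : H = ⊤ := by
  rw [eq_top_iff]
  intro σ _
  -- The pairs are the images of (x, y) under σh for h ∈ H. Reaching (x, y) itself means σh = 1.
  have key := standard_pair_of_nielsen_closed
    (fun a b => ∃ h ∈ H, σ (h x) = a ∧ σ (h y) = b) ?_ ?_ ?_ ?_ ?_ ?_ ⟨_, _, 1, H.one_mem, rfl, rfl⟩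
  · obtain ⟨h, hh, h1, h2⟩ := key
    have : σ * h = 1 := mulAut_ext h1 h2
    rw [eq_inv_of_mul_eq_one_left this]
    exact H.inv_mem hh
  · rintro _ _ ⟨h, hh, rfl, rfl⟩
    have : FreeGroup.lift ![σ (h x), σ (h y)] = (σ * h).toMonoidHom := by
      refine FreeGroup.ext_hom _ _ fun i => ?_
      fin_cases i <;> simp [x, y]
    rw [this]
    exact (σ * h).surjective
  · rintro _ _ ⟨h, hh, rfl, rfl⟩ h1
    have : (σ * h) x = (σ * h) 1 := by rw [map_one]; exact h1
    exact FreeGroup.of_ne_one 0 ((σ * h).injective this)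
  · rintro _ _ ⟨h, hh, rfl, rfl⟩
    exact ⟨h * swapAut, H.mul_mem hh hs, by simp, by simp⟩
  · rintro _ _ ⟨h, hh, rfl, rfl⟩
    exact ⟨h * signAut ![-1, 1], H.mul_mem hh hi, by simp [signAut_x], by simp [signAut_y]⟩
  · rintro _ _ ⟨h, hh, rfl, rfl⟩
    exact ⟨h * transvAut, H.mul_mem hh ht, by simp, by simp⟩
  · rintro _ _ g ⟨h, hh, rfl, rfl⟩
    refine ⟨MulAut.conj (σ⁻¹ g) * h, H.mul_mem (hInt ⟨_, rfl⟩) hh, ?_, ?_⟩ <;> simp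

/-! ### The subgroup `Int F · ν₀(Φ)` and its overgroup of automorphisms trivial modulo `2` -/

instance : intF.Normal := by
  refine ⟨?_⟩
  rintro _ ⟨g, rfl⟩ σ
  refine ⟨σ g, ?_⟩
  ext h
  simp

theorem nu0_range_le {K : Subgroup (MulAut F)} (ha : alpha ∈ K) (hb : beta ∈ K) :
    nu0.range ≤ K := by
  rw [nu0, FreeGroup.range_lift_eq_closure, Subgroup.closure_le]
  rintro _ ⟨i, rfl⟩
  fin_cases i <;> assumption

theorem alpha_mem_range : alpha ∈ nu0.range := ⟨FreeGroup.of 0, by simp [nu0]⟩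
theorem beta_mem_range : beta ∈ nu0.range := ⟨FreeGroup.of 1, by simp [nu0]⟩

/-- `Int F · ν₀(Φ)`. -/
def intNu : Subgroup (MulAut F) := intF ⊔ nu0.range

theorem intF_le_intNu : intF ≤ intNu := le_sup_left
theorem alpha_mem_intNu : alpha ∈ intNu := (le_sup_right : nu0.range ≤ _) alpha_mem_range
theorem beta_mem_intNu : beta ∈ intNu := (le_sup_right : nu0.range ≤ _) beta_mem_range

theorem mem_intNu {σ : MulAut F} : σ ∈ intNu ↔ ∃ g r, σ = MulAut.conj g * nu0 r := by
  rw [intNu, Subgroup.mem_sup_of_normal_left]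
  constructor
  · rintro ⟨_, ⟨g, rfl⟩, _, ⟨r, rfl⟩, rfl⟩
    exact ⟨g, r, rfl⟩
  · rintro ⟨g, r, rfl⟩
    exact ⟨_, ⟨g, rfl⟩, _, ⟨r, rfl⟩, rfl⟩

theorem intNu_le {K : Subgroup (MulAut F)} (hi : intF ≤ K) (ha : alpha ∈ K) (hb : beta ∈ K) :
    intNu ≤ K := sup_le hi (nu0_range_le ha hb)

theorem conj_intNu_le {K : Subgroup (MulAut F)} (hi : intF ≤ K) (g : MulAut F)
    (ha : g * alpha * g⁻¹ ∈ K) (hb : g * beta * g⁻¹ ∈ K) {σ : MulAut F} (hσ : σ ∈ intNu) :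
    g * σ * g⁻¹ ∈ K := by
  have : intNu ≤ K.comap (MulAut.conj g).toMonoidHom := by
    refine intNu_le ?_ ha hb
    intro τ hτ
    exact hi ((inferInstance : intF.Normal).conj_mem τ hτ g)
  exact this hσ

theorem signAut_mul_alpha (s : Fin 2 → ℤˣ) :
    ∃ (g : F) (e : ℤ), signAut s * alpha = MulAut.conj g * alpha ^ e * signAut s := by
  rcases Int.units_eq_one_or (s 0) with h0 | h0 <;> rcases Int.units_eq_one_or (s 1) with h1 | h1
  · refine ⟨1, 1, mulAut_ext ?_ ?_⟩ <;> simp [signAut_x, signAut_y, h0, h1]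
  · refine ⟨(x * x)⁻¹, -1, mulAut_ext ?_ ?_⟩ <;> simp [signAut_x, signAut_y, h0, h1, pow_two] <;> group
  · refine ⟨1, -1, mulAut_ext ?_ ?_⟩ <;> simp [signAut_x, signAut_y, h0, h1]
  · refine ⟨x * x, 1, mulAut_ext ?_ ?_⟩ <;> simp [signAut_x, signAut_y, h0, h1] <;> group

theorem signAut_mul_beta (s : Fin 2 → ℤˣ) :
    ∃ (g : F) (e : ℤ), signAut s * beta = MulAut.conj g * beta ^ e * signAut s := by
  rcases Int.units_eq_one_or (s 0) with h0 | h0 <;> rcases Int.units_eq_one_or (s 1) with h1 | h1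
  · refine ⟨1, 1, mulAut_ext ?_ ?_⟩ <;> simp [signAut_x, signAut_y, h0, h1]
  · refine ⟨1, -1, mulAut_ext ?_ ?_⟩ <;> simp [signAut_x, signAut_y, h0, h1]
  · refine ⟨(y * y)⁻¹, -1, mulAut_ext ?_ ?_⟩ <;> simp [signAut_x, signAut_y, h0, h1, pow_two] <;> group
  · refine ⟨y * y, 1, mulAut_ext ?_ ?_⟩ <;> simp [signAut_x, signAut_y, h0, h1] <;> group

theorem signAut_conj_intNu (s : Fin 2 → ℤˣ) {σ : MulAut F} (hσ : σ ∈ intNu) :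
    signAut s * σ * (signAut s)⁻¹ ∈ intNu := by
  refine conj_intNu_le intF_le_intNu _ ?_ ?_ hσ
  · obtain ⟨g, e, h⟩ := signAut_mul_alpha s
    rw [h, mul_inv_cancel_right]
    exact mul_mem (intF_le_intNu ⟨g, rfl⟩) (zpow_mem alpha_mem_intNu e)
  · obtain ⟨g, e, h⟩ := signAut_mul_beta s
    rw [h, mul_inv_cancel_right]
    exact mul_mem (intF_le_intNu ⟨g, rfl⟩) (zpow_mem beta_mem_intNu e)

/-- The automorphisms generated by `Int F`, `ν₀(Φ)` and the sign changes. -/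
def evenAut : Subgroup (MulAut F) := intNu ⊔ signAut.range

theorem intNu_le_evenAut : intNu ≤ evenAut := le_sup_left
theorem intF_le_evenAut : intF ≤ evenAut := intF_le_intNu.trans intNu_le_evenAut
theorem signAut_mem_evenAut (s : Fin 2 → ℤˣ) : signAut s ∈ evenAut :=
  (le_sup_right : signAut.range ≤ _) ⟨s, rfl⟩

theorem mem_evenAut {σ : MulAut F} (hσ : σ ∈ evenAut) : ∃ τ ∈ intNu, ∃ s, σ = τ * signAut s := by
  rw [evenAut, Subgroup.sup_eq_closure] at hσ
  induction hσ using Subgroup.closure_induction with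
  | mem σ h =>
    rcases h with h | ⟨s, rfl⟩
    · exact ⟨σ, h, 1, by simp⟩
    · exact ⟨1, one_mem _, s, by simp⟩
  | one => exact ⟨1, one_mem _, 1, by simp⟩
  | mul σ₁ σ₂ _ _ h₁ h₂ =>
    obtain ⟨τ₁, h₁, s₁, rfl⟩ := h₁
    obtain ⟨τ₂, h₂, s₂, rfl⟩ := h₂
    refine ⟨τ₁ * (signAut s₁ * τ₂ * (signAut s₁)⁻¹), mul_mem h₁ (signAut_conj_intNu _ h₂),
      s₁ * s₂, ?_⟩
    rw [map_mul]; group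
  | inv σ _ h =>
    obtain ⟨τ, h, s, rfl⟩ := h
    refine ⟨_, signAut_conj_intNu s⁻¹ (inv_mem h), s⁻¹, ?_⟩
    rw [map_inv]; group

theorem swapAut_mul_self : swapAut * swapAut = 1 := by
  refine mulAut_ext ?_ ?_ <;> simp

theorem transvAut_mul_self : transvAut * transvAut = beta := by
  refine mulAut_ext ?_ ?_ <;> simp [pow_two, mul_assoc]

theorem transvAut_mul_alpha : transvAut * alpha =
    MulAut.conj (y⁻¹ * x⁻¹) * beta * alpha⁻¹ * signAut ![-1, -1] * transvAut := by
  refine mulAut_ext ?_ ?_ <;> simp [signAut_x, signAut_y, pow_two, mul_assoc]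

theorem transvAut_mul_signAut (s : Fin 2 → ℤˣ) :
    ∃ τ ∈ intNu, transvAut * signAut s = τ * signAut s * transvAut := by
  rcases Int.units_eq_one_or (s 0) with h0 | h0 <;> rcases Int.units_eq_one_or (s 1) with h1 | h1
  · refine ⟨1, one_mem _, mulAut_ext ?_ ?_⟩ <;> simp [signAut_x, signAut_y, h0, h1]
  · refine ⟨beta, beta_mem_intNu, mulAut_ext ?_ ?_⟩ <;>
      simp [signAut_x, signAut_y, h0, h1, pow_two, mul_assoc]
  · refine ⟨MulAut.conj y * beta, mul_mem (intF_le_intNu ⟨_, rfl⟩) beta_mem_intNu,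
      mulAut_ext ?_ ?_⟩ <;> simp [signAut_x, signAut_y, h0, h1] <;> group
  · refine ⟨MulAut.conj y⁻¹, intF_le_intNu ⟨_, rfl⟩, mulAut_ext ?_ ?_⟩ <;>
      simp [signAut_x, signAut_y, h0, h1] <;> group

/-- Modulo `evenAut` this is the braid relation; as both generators become involutions there, Aut F
modulo `evenAut` is a quotient of S₃. -/
theorem braid_relation : transvAut * swapAut * transvAut =
    MulAut.conj y * beta * signAut ![1, -1] * (swapAut * transvAut * swapAut) := by
  refine mulAut_ext ?_ ?_ <;> simp [signAut_x, signAut_y] <;> group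

theorem conj_evenAut_le (g : MulAut F) (ha : g * alpha * g⁻¹ ∈ evenAut)
    (hb : g * beta * g⁻¹ ∈ evenAut) (hs : ∀ s, g * signAut s * g⁻¹ ∈ evenAut) (σ : MulAut F)
    (hσ : σ ∈ evenAut) : g * σ * g⁻¹ ∈ evenAut := by
  have : evenAut ≤ evenAut.comap (MulAut.conj g).toMonoidHom := by
    refine sup_le (fun τ hτ => conj_intNu_le intF_le_evenAut g ha hb hτ) ?_
    rintro _ ⟨s, rfl⟩
    exact hs s
  exact this hσ

/-- Only one inclusion has to be checked, because conjugation by g² ∈ H supplies the reverse one. -/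
theorem mem_normalizer_of_sq_mem {G : Type*} [Group G] {H : Subgroup G} {g : G}
    (h : ∀ a ∈ H, g * a * g⁻¹ ∈ H) (hg : g * g ∈ H) : g ∈ Subgroup.normalizer (H : Set G) := by
  rw [Subgroup.mem_normalizer_iff]
  intro a
  refine ⟨h a, fun ha => ?_⟩
  have h1 := h _ ha
  have : g * (g * a * g⁻¹) * g⁻¹ = (g * g) * a * (g * g)⁻¹ := by group
  rw [this] at h1
  rwa [Subgroup.mul_mem_cancel_right _ (inv_mem hg), Subgroup.mul_mem_cancel_left _ hg] at h1

instance evenAut_normal : evenAut.Normal := by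
  rw [← Subgroup.normalizer_eq_top_iff]
  refine eq_top_of_nielsen_mem _ (intF_le_evenAut.trans Subgroup.le_normalizer) ?_
    (Subgroup.le_normalizer (signAut_mem_evenAut _)) ?_
  · refine mem_normalizer_of_sq_mem (conj_evenAut_le _ ?_ ?_ ?_) ?_
    · have : swapAut * alpha * swapAut⁻¹ = beta := by
        rw [mul_inv_eq_iff_eq_mul]; refine mulAut_ext ?_ ?_ <;> simp
      rw [this]; exact intNu_le_evenAut beta_mem_intNu
    · have : swapAut * beta * swapAut⁻¹ = alpha := by
        rw [mul_inv_eq_iff_eq_mul]; refine mulAut_ext ?_ ?_ <;> simp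
      rw [this]; exact intNu_le_evenAut alpha_mem_intNu
    · intro s
      have : swapAut * signAut s * swapAut⁻¹ = signAut ![s 1, s 0] := by
        rw [mul_inv_eq_iff_eq_mul]
        refine mulAut_ext ?_ ?_ <;> simp [signAut_x, signAut_y]
      rw [this]; exact signAut_mem_evenAut _
    · rw [swapAut_mul_self]; exact one_mem _
  · have hβ := intNu_le_evenAut beta_mem_intNu
    refine mem_normalizer_of_sq_mem (conj_evenAut_le _ ?_ ?_ ?_) ?_
    · rw [transvAut_mul_alpha, mul_inv_cancel_right]
      exact mul_mem (mul_mem (mul_mem (intF_le_evenAut ⟨_, rfl⟩) hβ)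
        (inv_mem (intNu_le_evenAut alpha_mem_intNu))) (signAut_mem_evenAut _)
    · have : transvAut * beta * transvAut⁻¹ = beta := by
        rw [mul_inv_eq_iff_eq_mul]; refine mulAut_ext ?_ ?_ <;> simp [pow_two, mul_assoc]
      rwa [this]
    · intro s
      obtain ⟨τ, hτ, h⟩ := transvAut_mul_signAut s
      rw [h, mul_inv_cancel_right]
      exact mul_mem (intNu_le_evenAut hτ) (signAut_mem_evenAut _)
    · rw [transvAut_mul_self]; exact hβ

/-- Two involutions satisfying the braid relation generate at most six elements. -/
theorem mem_six_of_braid {G : Type*} [Group G] {s t : G} (hs : s * s = 1) (ht : t * t = 1)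
    (hb : t * s * t = s * t * s) {g : G} (hg : g ∈ Subgroup.closure {s, t}) :
    g = 1 ∨ g = s ∨ g = t ∨ g = s * t ∨ g = t * s ∨ g = s * t * s := by
  have hs' : s⁻¹ = s := inv_eq_of_mul_eq_one_left hs
  have ht' : t⁻¹ = t := inv_eq_of_mul_eq_one_left ht
  have step : ∀ g : G, (g = 1 ∨ g = s ∨ g = t ∨ g = s * t ∨ g = t * s ∨ g = s * t * s) →
      ∀ u ∈ ({s, t} : Set G),
        (g * u = 1 ∨ g * u = s ∨ g * u = t ∨ g * u = s * t ∨ g * u = t * s ∨ g * u = s * t * s) := by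
    have h1 : s * t * s * t = t * s := by
      rw [mul_assoc s t s, mul_assoc s, hb, mul_assoc s t s, ← mul_assoc, hs, one_mul]
    rintro g (rfl | rfl | rfl | rfl | rfl | rfl) u (rfl | rfl) <;>
      simp_all [mul_assoc]
  refine Subgroup.closure_induction_right (p := fun g _ =>
    g = 1 ∨ g = s ∨ g = t ∨ g = s * t ∨ g = t * s ∨ g = s * t * s) (Or.inl rfl) ?_ ?_ hg
  · intro g _ u hu h
    exact step g h u hu
  · intro g _ u hu h
    have : u⁻¹ = u := by rcases hu with rfl | rfl <;> assumption
    rw [this]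
    exact step g h u hu

theorem exists_evenAut_mul (σ : MulAut F) : ∃ τ ∈ evenAut, ∃ w, σ = τ * w ∧
    (w = 1 ∨ w = swapAut ∨ w = transvAut ∨ w = swapAut * transvAut ∨ w = transvAut * swapAut ∨
      w = swapAut * transvAut * swapAut) := by
  let π := QuotientGroup.mk' evenAut
  have htop : (Subgroup.closure {π swapAut, π transvAut}).comap π = ⊤ := by
    refine eq_top_of_nielsen_mem _ ?_ ?_ ?_ ?_
    · intro τ hτ
      have : π τ = 1 := (QuotientGroup.eq_one_iff τ).2 (intF_le_evenAut hτ)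
      rw [Subgroup.mem_comap, this]; exact one_mem _
    · exact Subgroup.subset_closure (by simp)
    · have : π (signAut ![-1, 1]) = 1 := (QuotientGroup.eq_one_iff _).2 (signAut_mem_evenAut _)
      rw [Subgroup.mem_comap, this]; exact one_mem _
    · exact Subgroup.subset_closure (by simp)
  have hmem : π σ ∈ Subgroup.closure {π swapAut, π transvAut} := by
    rw [← Subgroup.mem_comap, htop]; trivial
  have hsix := mem_six_of_braid (by rw [← map_mul, swapAut_mul_self, map_one])
    (by
      rw [← map_mul, transvAut_mul_self]
      exact (QuotientGroup.eq_one_iff _).2 (intNu_le_evenAut beta_mem_intNu))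
    (by
      simp only [← map_mul]
      rw [braid_relation, map_mul]
      convert one_mul _
      exact (QuotientGroup.eq_one_iff _).2 (mul_mem (mul_mem (intF_le_evenAut ⟨_, rfl⟩)
        (intNu_le_evenAut beta_mem_intNu)) (signAut_mem_evenAut _))) hmem
  have fin : ∀ w, π σ = π w → ∃ τ ∈ evenAut, σ = τ * w := fun w h => by
    refine ⟨σ * w⁻¹, ?_, by group⟩
    rw [← QuotientGroup.eq_one_iff]
    change π _ = 1
    rw [map_mul, map_inv, h, mul_inv_cancel]
  simp only [← map_mul] at hsix
  rcases hsix with h | h | h | h | h | h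
  · obtain ⟨τ, h1, h2⟩ := fin 1 (by rw [h, map_one]); exact ⟨τ, h1, _, h2, by simp⟩
  all_goals obtain ⟨τ, h1, h2⟩ := fin _ h; exact ⟨τ, h1, _, h2, by simp⟩

/-! ### Action on the abelianization -/

theorem abMatrix_mul (σ τ : MulAut F) : abMatrix (σ * τ) = abMatrix σ * abMatrix τ :=
  congrArg Units.val (map_mul theta σ τ)

theorem abMatrix_conj (g : F) : abMatrix (MulAut.conj g) = 1 := by
  ext i j
  fin_cases i <;> fin_cases j <;> simp [abMatrix, expSum, mul_comm]

theorem abMatrix_signAut (s : Fin 2 → ℤˣ) : abMatrix (signAut s) = !![(s 0 : ℤ), 0; 0, (s 1 : ℤ)] := by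
  ext i j
  fin_cases i <;> fin_cases j <;> simp [abMatrix, expSum, signAut]

theorem abMatrix_alpha : abMatrix alpha = !![1, 2; 0, 1] := by
  ext i j
  fin_cases i <;> fin_cases j <;> simp [abMatrix, expSum, alpha, x, y]

theorem abMatrix_alpha_inv : abMatrix alpha⁻¹ = !![1, -2; 0, 1] := by
  have h0 : alpha.symm (FreeGroup.of 0) = _ := alpha_symm_x
  have h1 : alpha.symm (FreeGroup.of 1) = _ := alpha_symm_y
  ext i j
  fin_cases i <;> fin_cases j <;> simp [abMatrix, expSum, h0, h1] <;> simp [x, y]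

theorem abMatrix_beta : abMatrix beta = !![1, 0; 2, 1] := by
  ext i j
  fin_cases i <;> fin_cases j <;> simp [abMatrix, expSum, beta, x, y]

theorem abMatrix_beta_inv : abMatrix beta⁻¹ = !![1, 0; -2, 1] := by
  have h0 : beta.symm (FreeGroup.of 0) = _ := beta_symm_x
  have h1 : beta.symm (FreeGroup.of 1) = _ := beta_symm_y
  ext i j
  fin_cases i <;> fin_cases j <;> simp [abMatrix, expSum, h0, h1] <;> simp [x, y]

theorem abMatrix_swapAut : abMatrix swapAut = !![0, 1; 1, 0] := by
  ext i j
  fin_cases i <;> fin_cases j <;> simp [abMatrix, expSum, swapAut, x, y]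

theorem abMatrix_transvAut : abMatrix transvAut = !![1, 0; 1, 1] := by
  ext i j
  fin_cases i <;> fin_cases j <;> simp [abMatrix, expSum, transvAut, x, y]

/-- Integer matrices with diagonal `≡ 1` modulo `4` and even off-diagonal entries. -/
def IsSanov (A : Matrix (Fin 2) (Fin 2) ℤ) : Prop :=
  4 ∣ A 0 0 - 1 ∧ 4 ∣ A 1 1 - 1 ∧ 2 ∣ A 0 1 ∧ 2 ∣ A 1 0

theorem IsSanov.mul {A B : Matrix (Fin 2) (Fin 2) ℤ} (hA : IsSanov A) (hB : IsSanov B) :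
    IsSanov (A * B) := by
  obtain ⟨⟨a, ha⟩, ⟨b, hb⟩, ⟨c, hc⟩, ⟨d, hd⟩⟩ := hA
  obtain ⟨⟨a', ha'⟩, ⟨b', hb'⟩, ⟨c', hc'⟩, ⟨d', hd'⟩⟩ := hB
  rw [sub_eq_iff_eq_add] at ha hb ha' hb'
  simp only [IsSanov, Matrix.mul_apply, Fin.sum_univ_two, ha, hb, hc, hd, ha', hb', hc', hd']
  exact ⟨⟨4 * a * a' + a + a' + c * d', by ring⟩, ⟨4 * b * b' + b + b' + d * c', by ring⟩,
    ⟨4 * a * c' + c' + 4 * c * b' + c, by ring⟩, ⟨4 * d * a' + d + 4 * b * d' + d', by ring⟩⟩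

theorem isSanov_nu0 (r : Phi) : IsSanov (abMatrix (nu0 r)) := by
  have h : ∀ i : Fin 2, IsSanov (abMatrix (nu0 (FreeGroup.of i))) ∧
      IsSanov (abMatrix (nu0 (FreeGroup.of i)⁻¹)) := by
    intro i
    have ha : nu0 (FreeGroup.of 0) = alpha := by simp [nu0]
    have hb : nu0 (FreeGroup.of 1) = beta := by simp [nu0]
    fin_cases i
    · simp only [Fin.zero_eta, map_inv, ha, abMatrix_alpha, abMatrix_alpha_inv]
      simp [IsSanov]
    · simp only [Fin.mk_one, map_inv, hb, abMatrix_beta, abMatrix_beta_inv]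
      simp [IsSanov]
  induction r using FreeGroup.induction_on with
  | C1 =>
    have : abMatrix 1 = 1 := congrArg Units.val (map_one theta)
    rw [map_one, this]
    simp [IsSanov]
  | of i => exact (h i).1
  | inv_of i _ => exact (h i).2
  | mul r s hr hs => rw [map_mul, abMatrix_mul]; exact hr.mul hs

theorem isSanov_of_mem_intNu {σ : MulAut F} (hσ : σ ∈ intNu) : IsSanov (abMatrix σ) := by
  obtain ⟨g, r, rfl⟩ := mem_intNu.1 hσ
  rw [abMatrix_mul, abMatrix_conj, one_mul]
  exact isSanov_nu0 r

/-- An automorphism acting trivially on `F^ab` modulo `4` lies in `Int F · ν₀(Φ)`. -/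
theorem mem_intNu_of_abMatrix (σ : MulAut F) (h00 : 4 ∣ abMatrix σ 0 0 - 1)
    (h11 : 4 ∣ abMatrix σ 1 1 - 1) (h01 : 4 ∣ abMatrix σ 0 1) (h10 : 4 ∣ abMatrix σ 1 0) :
    σ ∈ intNu := by
  obtain ⟨τ, hτ, w, rfl, hw⟩ := exists_evenAut_mul σ
  obtain ⟨ρ, hρ, s, rfl⟩ := mem_evenAut hτ
  obtain ⟨⟨a, ha⟩, ⟨b, hb⟩, ⟨c, hc⟩, ⟨d, hd⟩⟩ := isSanov_of_mem_intNu hρ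
  rw [sub_eq_iff_eq_add] at ha hb
  rcases hw with rfl | rfl | rfl | rfl | rfl | rfl
  -- Here only the signs remain, and the diagonal entries modulo 4 exclude -1.
  · rw [mul_one] at *
    rw [abMatrix_mul, abMatrix_signAut] at h00 h11
    simp only [Matrix.mul_apply, Fin.sum_univ_two, ha, hb, hc, hd] at h00 h11
    have hs : s = 1 := by
      ext i
      rcases Int.units_eq_one_or (s 0) with h0 | h0 <;>
        rcases Int.units_eq_one_or (s 1) with h1 | h1 <;> simp [h0, h1] at h00 h11 <;>
        fin_cases i <;> simp [h0, h1] <;> omega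
    rw [hs, map_one, mul_one]
    exact hρ
  -- Modulo 2 the factors ρ and s are trivial, while w is one of the five nontrivial elements of
  -- GL₂(𝔽₂).
  all_goals
    exfalso
    simp only [abMatrix_mul, abMatrix_signAut, abMatrix_swapAut, abMatrix_transvAut,
      Matrix.mul_apply, Fin.sum_univ_two, ha, hb, hc, hd] at h00 h11 h01 h10
    rcases Int.units_eq_one_or (s 0) with h0 | h0 <;>
      rcases Int.units_eq_one_or (s 1) with h1 | h1 <;> simp [h0, h1] at h00 h11 h01 h10 <;>
      omega

theorem nu0_range_le_autPrime : nu0.range ≤ autPrime := by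
  refine nu0_range_le ?_ ?_
  · refine ⟨_, Subgroup.subset_closure (Or.inl rfl), ?_⟩
    ext : 1
    exact abMatrix_alpha.symm
  · refine ⟨_, Subgroup.subset_closure (Or.inr rfl), ?_⟩
    ext : 1
    exact abMatrix_beta.symm

/-! ### Cocycles on free groups with values in functions on a quotient -/

/-- A crossed homomorphism is the left component of a homomorphism to (Q → A) ⋊ Q, and the latter
may be prescribed freely on generators. -/
theorem exists_cocycle {α Q A : Type*} [Group Q] [AddCommGroup A] (π : FreeGroup α →* Q)
    (f : α → Q → A) :
    ∃ C : FreeGroup α → Q → A, (∀ i h, C (FreeGroup.of i) h = f i h) ∧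
      ∀ v w h, C (v * w) h = C v h + C w ((π v)⁻¹ * h) := by
  let Θ : FreeGroup α →* (Q → Multiplicative A) ⋊[mulAutArrow] Q :=
    FreeGroup.lift fun i => ⟨fun h => Multiplicative.ofAdd (f i h), π (FreeGroup.of i)⟩
  have hr : ∀ w, (Θ w).right = π w := by
    have : SemidirectProduct.rightHom.comp Θ = π :=
      FreeGroup.ext_hom _ _ fun i => by simp [Θ]
    exact fun w => DFunLike.congr_fun this w
  refine ⟨fun w h => ((Θ w).left h).toAdd, fun i h => by simp [Θ], fun v w h => ?_⟩
  simp only [map_mul, SemidirectProduct.mul_left, Pi.mul_apply, toAdd_mul, hr]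
  rfl

section Cocycle

variable {H Q A : Type*} [Group H] [Group Q] [AddCommGroup A] {π : H →* Q} {C : H → Q → A}

theorem cocycle_one (hC : ∀ v w h, C (v * w) h = C v h + C w ((π v)⁻¹ * h)) (h : Q) :
    C 1 h = 0 := by
  have := hC 1 1 h
  simpa using this

theorem cocycle_inv (hC : ∀ v w h, C (v * w) h = C v h + C w ((π v)⁻¹ * h)) (w : H) (h : Q) :
    C w⁻¹ h = - C w (π w * h) := by
  have := hC w⁻¹ w h
  rw [inv_mul_cancel, cocycle_one hC, map_inv, inv_inv] at this
  exact eq_neg_of_add_eq_zero_left this.symm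

/-- On T the twist disappears, so the cocycle restricts to a homomorphism into an abelian group of
exponent dividing q. -/
theorem cocycle_powComm (hC : ∀ v w h, C (v * w) h = C v h + C w ((π v)⁻¹ * h)) {q : ℕ}
    (hA : ∀ a : A, q • a = 0) {T : Subgroup H} (hT : ∀ t ∈ T, π t = 1) {u : H}
    (hu : u ∈ powComm q T) : π u = 1 ∧ ∀ h, C u h = 0 := by
  let K : Subgroup H :=
    { carrier := {w | π w = 1 ∧ ∀ h, C w h = 0}
      one_mem' := ⟨map_one π, cocycle_one hC⟩
      mul_mem' := by
        rintro v w ⟨h1, h2⟩ ⟨h3, h4⟩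
        exact ⟨by rw [map_mul, h1, h3, one_mul], fun h => by rw [hC, h2, h4, add_zero]⟩
      inv_mem' := by
        rintro w ⟨h1, h2⟩
        exact ⟨by rw [map_inv, h1, inv_one], fun h => by rw [cocycle_inv hC, h2, neg_zero]⟩ }
  have : powComm q T ≤ K := by
    refine sup_le ?_ ?_
    · rw [Subgroup.closure_le]
      rintro _ ⟨t, ht, rfl⟩
      refine ⟨by simp [hT t ht], fun h => ?_⟩
      have : ∀ n : ℕ, C (t ^ n) h = n • C t h := by
        intro n
        induction n with
        | zero => simp [cocycle_one hC]
        | succ n ih => rw [pow_succ, hC, ih, map_pow, hT t ht, one_pow, inv_one, one_mul, succ_nsmul]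
      change C (t ^ q) h = 0
      rw [this, hA]
    · rw [Subgroup.commutator_le]
      intro a ha b hb
      refine ⟨by simp [commutatorElement_def, hT a ha, hT b hb], fun h => ?_⟩
      simp [commutatorElement_def, hC, cocycle_inv hC, hT a ha, hT b hb]
  exact this hu

/-- Since gw and wg differ by an element of T^q[T,T], their cocycles agree; expanding both gives the
identity. -/
theorem cocycle_of_commute (hC : ∀ v w h, C (v * w) h = C v h + C w ((π v)⁻¹ * h)) {q : ℕ}
    (hA : ∀ a : A, q • a = 0) {T : Subgroup H} (hT : ∀ t ∈ T, π t = 1) {g w : H}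
    (hu : g * w * g⁻¹ * w⁻¹ ∈ powComm q T) (h : Q) :
    C g h - C g ((π w)⁻¹ * h) = C w h - C w ((π g)⁻¹ * h) := by
  obtain ⟨h1, h2⟩ := cocycle_powComm hC hA hT hu
  have e : g * w = (g * w * g⁻¹ * w⁻¹) * (w * g) := by group
  have h3 := hC g w h
  rw [e, hC, h2, h1, zero_add, inv_one, one_mul, hC] at h3
  rw [sub_eq_sub_iff_add_eq_add, ← h3, add_comm]

theorem sum_subgroup_sub_translate {Q A : Type*} [Group Q] [AddCommGroup A] (O : Subgroup Q)
    [Fintype O] (E : Q → A) {z : Q} (hz : z ∈ O) : ∑ o : O, (E o - E (z⁻¹ * o)) = 0 := by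
  rw [Finset.sum_sub_distrib, sub_eq_zero]
  exact (Fintype.sum_equiv (Equiv.mulLeft (⟨z, hz⟩ : O)⁻¹) _ _ fun o => by simp).symm

theorem sum_subgroup_indicator {Q A : Type*} [Group Q] [DecidableEq Q] [AddCommMonoidWithOne A]
    (O : Subgroup Q) [Fintype O] (u : Q) [Decidable (u ∈ O)] :
    ∑ o : O, (if (o : Q) = u then (1 : A) else 0) = if u ∈ O then 1 else 0 := by
  split_ifs with h
  · rw [Finset.sum_eq_single ⟨u, h⟩]
    · simp
    · intro b _ hb
      rw [if_neg]
      rintro rfl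
      exact hb rfl
    · simp
  · refine Finset.sum_eq_zero fun o _ => if_neg ?_
    rintro rfl
    exact h o.2

end Cocycle

theorem ZMod.one_ne_neg_one_of_odd {q : ℕ} (hq : q.Prime) (hodd : Odd q) : (1 : ZMod q) ≠ -1 := by
  have : Fact (2 < q) := ⟨by
    have := hq.two_le
    rcases hodd with ⟨k, hk⟩
    omega⟩
  exact (ZMod.neg_one_ne_one).symm

/-- An element that is central modulo `T^q[T,T]` lies in `T`. -/
theorem mem_of_central_mod_powComm {q : ℕ} (hq : q.Prime) (hodd : Odd q) (T : Subgroup F)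
    [T.Normal] [T.FiniteIndex] (d : F) (hd : ∀ w, d * w * d⁻¹ * w⁻¹ ∈ powComm q T) : d ∈ T := by
  classical
  have : Fact q.Prime := ⟨hq⟩
  let π := QuotientGroup.mk' T
  have hπ : ∀ t ∈ T, π t = 1 := fun t ht => (QuotientGroup.eq_one_iff t).2 ht
  have : Fintype (F ⧸ T) := Fintype.ofFinite _
  have hA : ∀ a : ZMod q, q • a = 0 := fun a => by simp
  have hne := ZMod.one_ne_neg_one_of_odd hq hodd
  -- Take the cocycle with value δ₁ on x and 0 on y. Summing the commutation identity for d and x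
  -- over ⟨x⟩ makes the d-side telescope to 0 and leaves 1 minus the indicator of d ∈ ⟨x⟩.
  have hdx : π d ∈ Subgroup.zpowers (π x) := by
    obtain ⟨C, hof, hC⟩ := exists_cocycle π
      (![fun h => if h = 1 then 1 else 0, fun _ => 0] : Fin 2 → F ⧸ T → ZMod q)
    have h1 := sum_subgroup_sub_translate (Subgroup.zpowers (π x)) (C d)
      (Subgroup.mem_zpowers (π x))
    simp only [cocycle_of_commute hC hA hπ (hd x)] at h1
    have hx : ∀ h, C x h = if h = 1 then 1 else 0 := fun h => hof 0 h
    simp only [hx, inv_mul_eq_one, Finset.sum_sub_distrib, @eq_comm _ (π d)] at h1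
    rw [sum_subgroup_indicator, sum_subgroup_indicator, if_pos (one_mem _)] at h1
    by_contra hcon
    rw [if_neg hcon] at h1
    simp at h1
  by_contra hdT
  have hd1 : π d ≠ 1 := fun h => hdT ((QuotientGroup.eq_one_iff d).1 h)
  -- Now the value is 0 on x and δ₁ on y. Commutation with x makes C(d) invariant under ⟨x⟩, which
  -- contains d; since d also commutes with y, the identities for y at 1 and at d have equal left
  -- sides, but their right sides are 1 and -1.
  obtain ⟨C, hof, hC⟩ := exists_cocycle π
    (![fun _ => 0, fun h => if h = 1 then 1 else 0] : Fin 2 → F ⧸ T → ZMod q)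
  have hx : ∀ h, C x h = 0 := fun h => hof 0 h
  have hy : ∀ h, C y h = if h = 1 then 1 else 0 := fun h => hof 1 h
  have hEx : ∀ z ∈ Subgroup.zpowers (π x), ∀ h, C d (z * h) = C d h := by
    intro z hz
    rw [Subgroup.zpowers_eq_closure] at hz
    induction hz using Subgroup.closure_induction with
    | mem z hz =>
      rw [Set.mem_singleton_iff] at hz
      subst hz
      intro h
      have := cocycle_of_commute hC hA hπ (hd x) (π x * h)
      simpa [hx, sub_eq_zero] using this
    | one => simp
    | mul a b _ _ ha hb => intro h; rw [mul_assoc, ha, hb]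
    | inv a _ ha => intro h; rw [← ha, mul_inv_cancel_left]
  have e1 := cocycle_of_commute hC hA hπ (hd y) 1
  have e2 := cocycle_of_commute hC hA hπ (hd y) (π d)
  have hcomm : (π y)⁻¹ * π d = π d * (π y)⁻¹ := by
    have := (cocycle_powComm hC hA hπ (hd y)).1
    simp only [map_mul, map_inv] at this
    have h2 : π d * π y = π y * π d := by
      rw [mul_inv_eq_one, mul_inv_eq_iff_eq_mul] at this
      exact this
    rw [inv_mul_eq_iff_eq_mul, ← mul_assoc, ← h2, mul_inv_cancel_right]
  have e3 := hEx _ hdx 1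
  rw [mul_one] at e3
  rw [hcomm, hEx _ hdx, e3] at e2
  simp only [mul_one] at e1
  rw [e1] at e2
  simp only [hy, inv_mul_cancel, inv_eq_one, if_neg hd1, if_true, sub_zero, zero_sub] at e2
  exact hne e2

/-- An element commuting with `[y,x]` modulo `T^q[T,T]` lies in `⟨[y,x]⟩ T`. -/
theorem mem_zpowers_of_commute_mod_powComm {q : ℕ} (hq : q.Prime) (hodd : Odd q) (T : Subgroup F)
    [T.Normal] [T.FiniteIndex] (g : F)
    (hg : g * (y * x * y⁻¹ * x⁻¹) * g⁻¹ * (y * x * y⁻¹ * x⁻¹)⁻¹ ∈ powComm q T) :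
    ∃ j : ℤ, ∃ t ∈ T, g = (y * x * y⁻¹ * x⁻¹) ^ j * t := by
  classical
  have : Fact q.Prime := ⟨hq⟩
  let π := QuotientGroup.mk' T
  have hπ : ∀ t ∈ T, π t = 1 := fun t ht => (QuotientGroup.eq_one_iff t).2 ht
  have : Fintype (F ⧸ T) := Fintype.ofFinite _
  have hA : ∀ a : ZMod q, q • a = 0 := fun a => by simp
  have hne := ZMod.one_ne_neg_one_of_odd hq hodd
  set c : F := y * x * y⁻¹ * x⁻¹ with hc
  set O := Subgroup.zpowers (π c) with hO
  suffices h : π g ∈ O by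
    obtain ⟨j, hj⟩ := Subgroup.mem_zpowers_iff.1 h
    refine ⟨j, (c ^ j)⁻¹ * g, ?_, by group⟩
    rw [← QuotientGroup.eq_one_iff]
    change π _ = 1
    rw [map_mul, map_inv, map_zpow, hj, inv_mul_cancel]
  by_contra hgO
  -- D collects the contribution of a delta function at u after summation over O = ⟨c⟩. Delta
  -- functions on y and on x give two invariance relations, which together make D constant; yet D(1)
  -- = 1 and D(g⁻¹) = -1 when g ∉ O.
  let D : F ⧸ T → ZMod q := fun u => (if u ∈ O then 1 else 0) - (if π g * u ∈ O then 1 else 0)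
  have hD : ∀ u, ∑ o : O, ((if (o : F ⧸ T) = u then (1 : ZMod q) else 0)
      - (if (o : F ⧸ T) = π g * u then 1 else 0)) = D u := fun u => by
    rw [Finset.sum_sub_distrib, sum_subgroup_indicator, sum_subgroup_indicator]
  have key : ∀ f : Fin 2 → F ⧸ T → ZMod q, ∑ o : O,
      ((f 1 o + f 0 ((π y)⁻¹ * o) - f 1 (π y * ((π x)⁻¹ * ((π y)⁻¹ * o)))
          - f 0 (π x * (π y * ((π x)⁻¹ * ((π y)⁻¹ * o)))))
      - (f 1 ((π g)⁻¹ * o) + f 0 ((π y)⁻¹ * ((π g)⁻¹ * o))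
          - f 1 (π y * ((π x)⁻¹ * ((π y)⁻¹ * ((π g)⁻¹ * o))))
          - f 0 (π x * (π y * ((π x)⁻¹ * ((π y)⁻¹ * ((π g)⁻¹ * o))))))) = 0 := by
    intro f
    obtain ⟨C, hof, hC⟩ := exists_cocycle π f
    have hx : ∀ h, C x h = f 0 h := hof 0
    have hy : ∀ h, C y h = f 1 h := hof 1
    have hCc : ∀ h, C c h = f 1 h + f 0 ((π y)⁻¹ * h) - f 1 (π y * ((π x)⁻¹ * ((π y)⁻¹ * h)))
          - f 0 (π x * (π y * ((π x)⁻¹ * ((π y)⁻¹ * h)))) := by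
      intro h
      rw [hc]
      simp only [hC, cocycle_inv hC, hx, hy, map_inv, inv_inv, mul_assoc]
      abel
    have h1 := sum_subgroup_sub_translate O (C g) (Subgroup.mem_zpowers (π c))
    simp only [cocycle_of_commute hC hA hπ hg, hCc] at h1
    exact h1
  have h1 : ∀ u, D (π y * (π x * ((π y)⁻¹ * u))) = D u := by
    intro u
    have := key ![fun _ => 0, fun h => if h = u then 1 else 0]
    rw [← sub_eq_zero, ← neg_eq_zero, ← hD, ← hD, ← Finset.sum_sub_distrib,
      ← Finset.sum_neg_distrib]
    refine (Finset.sum_congr rfl fun o _ => ?_).trans this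
    simp [← eq_inv_mul_iff_mul_eq]
    abel
  have h2 : ∀ u, D (π y * (π x * ((π y)⁻¹ * ((π x)⁻¹ * u)))) = D (π y * u) := by
    intro u
    have := key ![fun h => if h = u then 1 else 0, fun _ => 0]
    rw [← sub_eq_zero, ← neg_eq_zero, ← hD, ← hD, ← Finset.sum_sub_distrib,
      ← Finset.sum_neg_distrib]
    refine (Finset.sum_congr rfl fun o _ => ?_).trans this
    simp [← eq_inv_mul_iff_mul_eq]
    abel
  let I : Subgroup (F ⧸ T) :=
    { carrier := {k | ∀ u, D (k * u) = D u}
      one_mem' := fun u => by rw [one_mul]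
      mul_mem' := fun {a b} ha hb u => by rw [mul_assoc, ha, hb]
      inv_mem' := fun {a} ha u => by rw [← ha, mul_inv_cancel_left] }
  have i1 : π y * π x * (π y)⁻¹ ∈ I := fun u => by simpa only [mul_assoc] using h1 u
  have i2 : π y * π x ∈ I := fun u => by
    have := h2 (π x * u)
    rw [inv_mul_cancel_left, h1] at this
    rw [mul_assoc, this]
  have i3 : π y ∈ I := by
    have := mul_mem (inv_mem i1) i2
    simpa [mul_assoc] using this
  have i4 : π x ∈ I := by
    have := mul_mem (inv_mem i3) i2
    simpa using this
  have itop : ∀ w : F, π w ∈ I := by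
    intro w
    induction w using FreeGroup.induction_on with
    | C1 => rw [map_one]; exact one_mem _
    | of i =>
      fin_cases i
      · exact i4
      · exact i3
    | inv_of i h => rw [map_inv]; exact inv_mem h
    | mul a b ha hb => rw [map_mul]; exact mul_mem ha hb
  have h3 := itop g⁻¹ 1
  have h4 : (π g)⁻¹ ∉ O := fun h => hgO (by simpa using inv_mem h)
  simp only [D, mul_one, map_inv, mul_inv_cancel, one_mem, if_true, if_neg hgO, if_neg h4, zero_sub,
    sub_zero] at h3
  exact hne h3.symm

/-! ### The Schreier bound -/

/-- An Euler characteristic count on the Cayley graph of F/T: its 2[F:T] edges span V together with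
the [F:T] - 1 nontrivial vertices. This avoids a free basis of T. -/
theorem card_dvd_of_surjective_schreier {q : ℕ} [Fact q.Prime] (T : Subgroup F) [T.Normal]
    [T.FiniteIndex] {V : Type*} [AddCommGroup V] [Module (ZMod q) V] (χ : T →* Multiplicative V)
    (hχ : Function.Surjective χ) : Nat.card V ∣ q ^ (T.index + 1) := by
  classical
  let π := QuotientGroup.mk' T
  have : Fintype (F ⧸ T) := Fintype.ofFinite _
  obtain ⟨r, hr⟩ : ∃ r : F ⧸ T → F, ∀ h, π (r h) = h :=
    ⟨_, Function.surjInv_eq (QuotientGroup.mk'_surjective T)⟩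
  have hmem : ∀ w h, (r h)⁻¹ * w * r ((π w)⁻¹ * h) ∈ T := fun w h => by
    rw [← QuotientGroup.eq_one_iff]
    change π _ = 1
    simp only [map_mul, map_inv, hr]
    group
  -- View (w, h) as a path from w⁻¹h to h: the first component is χ of the loop closed up by the
  -- transversal r, the second is the boundary, with the base vertex discarded.
  let K : F → F ⧸ T → V × ({k : F ⧸ T // k ≠ 1} → ZMod q) := fun w h =>
    ((χ ⟨_, hmem w h⟩).toAdd, fun k => Pi.single (M := fun _ => ZMod q) h 1 k.1 -
      Pi.single (M := fun _ => ZMod q) ((π w)⁻¹ * h) 1 k.1)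
  have hK : ∀ v w h, K (v * w) h = K v h + K w ((π v)⁻¹ * h) := by
    intro v w h
    refine Prod.ext ?_ ?_
    · change (χ _).toAdd = (χ _).toAdd + (χ _).toAdd
      rw [← toAdd_mul, ← map_mul]
      congr 2
      ext : 1
      simp only [Subgroup.coe_mul, map_mul, mul_inv_rev, mul_assoc]
      group
    · funext k
      simp only [K, Prod.snd_add, Pi.add_apply, map_mul, mul_inv_rev, mul_assoc]
      abel
  let L := Fintype.linearCombination (ZMod q) (fun e : Fin 2 × (F ⧸ T) => K (FreeGroup.of e.1) e.2)
  have hrange : ∀ w h, K w h ∈ LinearMap.range L := by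
    intro w
    induction w using FreeGroup.induction_on with
    | C1 => intro h; rw [cocycle_one hK]; exact zero_mem _
    | of i =>
      intro h
      exact ⟨Pi.single (i, h) 1, by simp [L, Fintype.linearCombination_apply_single]⟩
    | inv_of i ih => intro h; rw [cocycle_inv hK]; exact neg_mem (ih _)
    | mul a b ha hb => intro h; rw [hK]; exact add_mem (ha _) (hb _)
  -- Loops at the base vertex have zero boundary and realize every value of χ.
  have hV : ∀ v : V, (v, 0) ∈ LinearMap.range L := by
    intro v
    obtain ⟨t, ht⟩ := hχ (Multiplicative.ofAdd v)
    have h1 := hrange (r 1 * t * (r 1)⁻¹) 1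
    have h2 : π (r 1 * t * (r 1)⁻¹) = 1 := by
      have : π t = 1 := (QuotientGroup.eq_one_iff _).2 t.2
      simp [this]
    convert h1 using 1
    refine Prod.ext ?_ ?_
    · change v = (χ _).toAdd
      rw [← toAdd_ofAdd v, ← ht]
      congr 2
      ext : 1
      simp only [h2]
      simp [mul_assoc]
    · funext k
      simp [K, h2]
  -- A path from the base vertex to k has boundary δ_k, and `hV` removes its V-component.
  have hS : ∀ k, ((0 : V), Pi.single k (1 : ZMod q)) ∈ LinearMap.range L := by
    intro k
    have h1 := hrange (r k) k
    have h2 := sub_mem h1 (hV (K (r k) k).1)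
    convert h2 using 1
    refine Prod.ext ?_ ?_
    · simp
    · funext j
      have hj := j.2
      simp [K, hr, Pi.single_apply, Subtype.ext_iff, hj]
  have hsurj : Function.Surjective L := by
    rw [← LinearMap.range_eq_top, eq_top_iff]
    rintro ⟨v, φ⟩ -
    have h1 : ((0 : V), φ) ∈ LinearMap.range L := by
      have : ((0 : V), φ) = ∑ k, φ k • ((0 : V), Pi.single k (1 : ZMod q)) := by
        refine Prod.ext ?_ ?_
        · simp [Prod.fst_sum]
        · funext j
          simp [Prod.snd_sum, Pi.single_apply]
      rw [this]
      exact sum_mem fun k _ => Submodule.smul_mem _ _ (hS k)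
    have := add_mem (hV v) h1
    simpa using this
  have hcard := AddSubgroup.card_dvd_of_surjective L.toAddMonoidHom hsurj
  have hindex : T.index = Fintype.card (F ⧸ T) := by
    rw [Subgroup.index_eq_card, Nat.card_eq_fintype_card]
  have hpos : 0 < Fintype.card (F ⧸ T) := Fintype.card_pos
  have hsub : Fintype.card {k : F ⧸ T // k ≠ 1} = T.index - 1 := by
    rw [hindex, Fintype.card_subtype_compl, Fintype.card_subtype_eq]
  have hW : Nat.card (V × ({k : F ⧸ T // k ≠ 1} → ZMod q)) = Nat.card V * q ^ (T.index - 1) := by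
    rw [Nat.card_prod, Nat.card_fun, Nat.card_zmod,
      Nat.card_eq_fintype_card (α := {k : F ⧸ T // k ≠ 1}), hsub]
  rw [hW, Nat.card_fun, Nat.card_zmod, Nat.card_prod, Nat.card_eq_fintype_card (α := Fin 2),
    Fintype.card_fin, ← Subgroup.index_eq_card,
    show 2 * T.index = (T.index + 1) + (T.index - 1) by omega, pow_add] at hcard
  exact Nat.dvd_of_mul_dvd_mul_right (pow_pos (Fact.out : q.Prime).pos _) hcard

/-! ### Functoriality of `powComm` and the Schreier bound for it -/

theorem powComm_le {G : Type*} [Group G] (k : ℕ) (H : Subgroup G) : powComm k H ≤ H := by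
  refine sup_le ?_ (Subgroup.commutator_le_self H)
  rw [Subgroup.closure_le]
  rintro _ ⟨h, hh, rfl⟩
  exact pow_mem hh k

theorem pow_mem_powComm {G : Type*} [Group G] (k : ℕ) {H : Subgroup G} {h : G} (hh : h ∈ H) :
    h ^ k ∈ powComm k H :=
  (le_sup_left : _ ≤ powComm k H) (Subgroup.subset_closure ⟨h, hh, rfl⟩)

theorem commutator_mem_powComm {G : Type*} [Group G] (k : ℕ) {H : Subgroup G} {a b : G}
    (ha : a ∈ H) (hb : b ∈ H) : a * b * a⁻¹ * b⁻¹ ∈ powComm k H :=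
  (le_sup_right : _ ≤ powComm k H) (Subgroup.commutator_mem_commutator ha hb)

/-- `H^k[H,H]` is preserved by every endomorphism preserving `H`. -/
theorem powComm_map_le {G G' : Type*} [Group G] [Group G'] (k : ℕ) {H : Subgroup G}
    {H' : Subgroup G'} (φ : G →* G') (hφ : ∀ h ∈ H, φ h ∈ H') {u : G} (hu : u ∈ powComm k H) :
    φ u ∈ powComm k H' := by
  have : powComm k H ≤ (powComm k H').comap φ := by
    refine sup_le ?_ ?_
    · rw [Subgroup.closure_le]
      rintro _ ⟨h, hh, rfl⟩
      change φ (h ^ k) ∈ powComm k H'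
      rw [map_pow]
      exact pow_mem_powComm k (hφ h hh)
    · rw [Subgroup.commutator_le]
      intro a ha b hb
      rw [Subgroup.mem_comap, commutatorElement_def]
      simp only [map_mul, map_inv]
      exact commutator_mem_powComm k (hφ a ha) (hφ b hb)
  exact this hu

theorem powComm_normal {G : Type*} [Group G] (k : ℕ) (H : Subgroup G) [hH : H.Normal] :
    (powComm k H).Normal :=
  ⟨fun _ hu g => powComm_map_le k (MulAut.conj g).toMonoidHom
    (H' := H) (fun h hh => hH.conj_mem h hh g) hu⟩

/-- The Schreier bound: `[T : T^q[T,T]]` divides `q^([F:T]+1)`. -/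
theorem relIndex_powComm_dvd {q : ℕ} (hq : q.Prime) (T : Subgroup F) [T.Normal]
    [T.FiniteIndex] : (powComm q T).relIndex T ∣ q ^ (T.index + 1) := by
  have : Fact q.Prime := ⟨hq⟩
  have := powComm_normal q T
  let U := (powComm q T).subgroupOf T
  let : CommGroup (T ⧸ U) :=
    { (inferInstance : Group (T ⧸ U)) with
      mul_comm := by
        rintro ⟨a⟩ ⟨b⟩
        refine (QuotientGroup.eq (s := U)).2 ?_
        rw [Subgroup.mem_subgroupOf]
        have := commutator_mem_powComm q (inv_mem b.2) (inv_mem a.2)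
        simpa [mul_assoc] using this }
  let : Module (ZMod q) (Additive (T ⧸ U)) := AddCommGroup.zmodModule (by
    rintro ⟨a⟩
    refine (QuotientGroup.eq_one_iff (N := U) (a ^ q)).2 ?_
    rw [Subgroup.mem_subgroupOf]
    exact pow_mem_powComm q a.2)
  have := card_dvd_of_surjective_schreier (q := q) (V := Additive (T ⧸ U)) T
    (QuotientGroup.mk' U) (QuotientGroup.mk'_surjective U)
  exact this

/-! ### Homomorphisms out of `Ψ` -/

/-- The homomorphism from the group of order two given by an involution. -/
def involutionHom {G : Type*} [Group G] (g : G) (hg : g * g = 1) : Multiplicative (ZMod 2) →* G where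
  toFun a := g ^ (a.toAdd.val)
  map_one' := by simp
  map_mul' a b := by
    induction a using Multiplicative.rec with | _ a
    induction b using Multiplicative.rec with | _ b
    fin_cases a <;> fin_cases b
    · change g ^ 0 = g ^ 0 * g ^ 0
      simp
    · change g ^ 1 = g ^ 0 * g ^ 1
      simp
    · change g ^ 1 = g ^ 1 * g ^ 0
      simp
    · change g ^ 0 = g ^ 1 * g ^ 1
      simp [hg]

/-- The homomorphism from `Ψ` given by three involutions. -/
def psiLift {G : Type*} [Group G] (g : Fin 3 → G) (hg : ∀ i, g i * g i = 1) : Psi →* G :=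
  Monoid.CoprodI.lift fun i => involutionHom (g i) (hg i)

@[simp] theorem psiLift_z {G : Type*} [Group G] (g : Fin 3 → G) (hg : ∀ i, g i * g i = 1)
    (i : Fin 3) : psiLift g hg (z i) = g i := by
  rw [psiLift, z, Monoid.CoprodI.lift_of]
  change g i ^ 1 = g i
  rw [pow_one]

theorem psi_closure : Subgroup.closure (Set.range z) = ⊤ := by
  rw [eq_top_iff]
  intro w _
  induction w using Monoid.CoprodI.induction_on with
  | one => exact one_mem _
  | of i a =>
    induction a using Multiplicative.rec with | _ a
    fin_cases a
    · have : (Monoid.CoprodI.of (i := i) (1 : Multiplicative (ZMod 2)) : Psi) = 1 := map_one _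
      exact this ▸ one_mem _
    · exact Subgroup.subset_closure ⟨i, rfl⟩
  | mul a b ha hb => exact mul_mem (ha trivial) (hb trivial)

theorem psi_hom_ext {G : Type*} [Group G] {f g : Psi →* G} (h : ∀ i, f (z i) = g (z i)) :
    f = g := by
  refine MonoidHom.eq_of_eqOn_dense psi_closure ?_
  rintro _ ⟨i, rfl⟩
  exact h i

@[simp] theorem z_mul_self (i : Fin 3) : z i * z i = 1 := by
  rw [z, ← map_mul]
  have : (Multiplicative.ofAdd (1 : ZMod 2)) * Multiplicative.ofAdd 1 = 1 := rfl
  rw [this, map_one]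

@[simp] theorem z_inv (i : Fin 3) : (z i)⁻¹ = z i := inv_eq_of_mul_eq_one_left (z_mul_self i)

@[simp] theorem z_mul_cancel (i : Fin 3) (w : Psi) : z i * (z i * w) = w := by
  rw [← mul_assoc, z_mul_self, one_mul]

/-! ### The action of `Φ` on `Ψ` and on `F′` -/

/-- The extension of `α` to `Ψ`. -/
def alphaPsi : MulAut Psi :=
  MonoidHom.toMulEquiv
    (psiLift ![z 1 * z 0 * z 1, z 1 * z 0 * z 1 * z 0 * z 1,
        z 1 * z 0 * z 1 * z 0 * z 2 * z 0 * z 1 * z 0 * z 1]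
      (fun i => by fin_cases i <;> simp [mul_assoc]))
    (psiLift ![z 0 * z 1 * z 0 * z 1 * z 0, z 0 * z 1 * z 0,
        z 0 * z 1 * z 0 * z 1 * z 2 * z 1 * z 0 * z 1 * z 0]
      (fun i => by fin_cases i <;> simp [mul_assoc]))
    (psi_hom_ext fun i => by fin_cases i <;> simp [mul_assoc])
    (psi_hom_ext fun i => by fin_cases i <;> simp [mul_assoc])

/-- The extension of `β` to `Ψ`. -/
def betaPsi : MulAut Psi :=
  MonoidHom.toMulEquiv
    (psiLift ![z 0, z 2 * z 1 * z 2, z 2 * z 1 * z 2 * z 1 * z 2]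
      (fun i => by fin_cases i <;> simp [mul_assoc]))
    (psiLift ![z 0, z 1 * z 2 * z 1 * z 2 * z 1, z 1 * z 2 * z 1]
      (fun i => by fin_cases i <;> simp [mul_assoc]))
    (psi_hom_ext fun i => by fin_cases i <;> simp [mul_assoc])
    (psi_hom_ext fun i => by fin_cases i <;> simp [mul_assoc])

theorem alphaPsi_z (i : Fin 3) : alphaPsi (z i) =
    ![z 1 * z 0 * z 1, z 1 * z 0 * z 1 * z 0 * z 1,
        z 1 * z 0 * z 1 * z 0 * z 2 * z 0 * z 1 * z 0 * z 1] i := by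
  simp [alphaPsi]

theorem betaPsi_z (i : Fin 3) : betaPsi (z i) =
    ![z 0, z 2 * z 1 * z 2, z 2 * z 1 * z 2 * z 1 * z 2] i := by
  simp [betaPsi]

/-- The action of `Φ` on `Ψ` extending `ν₀`. -/
def nuPsi : Phi →* MulAut Psi := FreeGroup.lift ![alphaPsi, betaPsi]

/-- The restriction of `alphaPsi` to `F′`. -/
def alphaF' : MulAut (FreeGroup (Fin 3)) :=
  MonoidHom.toMulEquiv
    (FreeGroup.lift ![(.of 0 * .of 2)⁻¹ * .of 0 * (.of 0 * .of 2), .of 1,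
      (.of 0 * .of 2)⁻¹ * .of 2 * (.of 0 * .of 2)])
    (FreeGroup.lift ![(.of 0 * .of 2) * .of 0 * (.of 0 * .of 2)⁻¹, .of 1,
      (.of 0 * .of 2) * .of 2 * (.of 0 * .of 2)⁻¹])
    (FreeGroup.ext_hom _ _ fun i => by fin_cases i <;> simp [mul_assoc])
    (FreeGroup.ext_hom _ _ fun i => by fin_cases i <;> simp [mul_assoc])

/-- The restriction of `betaPsi` to `F′`. -/
def betaF' : MulAut (FreeGroup (Fin 3)) :=
  MonoidHom.toMulEquiv
    (FreeGroup.lift ![.of 0, .of 1, (.of 1 * .of 0)⁻¹ * .of 2 * (.of 1 * .of 0)])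
    (FreeGroup.lift ![.of 0, .of 1, (.of 1 * .of 0) * .of 2 * (.of 1 * .of 0)⁻¹])
    (FreeGroup.ext_hom _ _ fun i => by fin_cases i <;> simp [mul_assoc])
    (FreeGroup.ext_hom _ _ fun i => by fin_cases i <;> simp [mul_assoc])

/-- The action of `Φ` on `F′`. -/
def nuF' : Phi →* MulAut (FreeGroup (Fin 3)) := FreeGroup.lift ![alphaF', betaF']

theorem equivariant_of_generators {ι G H : Type*} [Group G] [Group H] (ν : FreeGroup ι →* MulAut G)
    (μ : FreeGroup ι →* MulAut H) (i : G →* H)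
    (h : ∀ a, i.comp (ν (FreeGroup.of a)).toMonoidHom = (μ (FreeGroup.of a)).toMonoidHom.comp i)
    (r : FreeGroup ι) (g : G) : i (ν r g) = μ r (i g) := by
  induction r using FreeGroup.induction_on generalizing g with
  | C1 => simp
  | of a => exact DFunLike.congr_fun (h a) g
  | inv_of a ih =>
    have h1 := ih (ν (FreeGroup.of a)⁻¹ g)
    rw [← MulAut.mul_apply, ← map_mul, mul_inv_cancel, map_one, MulAut.one_apply] at h1
    rw [h1, ← MulAut.mul_apply, ← map_mul, inv_mul_cancel, map_one, MulAut.one_apply]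
  | mul a b ha hb => rw [map_mul, map_mul, MulAut.mul_apply, MulAut.mul_apply, ha, hb]

theorem inclF_x : inclF x = z 0 * z 1 := by simp [inclF, x]
theorem inclF_y : inclF y = z 1 * z 2 := by simp [inclF, y]

theorem inclF_nu0 (r : Phi) (h : F) : inclF (nu0 r h) = nuPsi r (inclF h) := by
  refine equivariant_of_generators nu0 nuPsi inclF (fun a => FreeGroup.ext_hom _ _ fun i => ?_) r h
  fin_cases a
  · change Fin 2 at i
    have h0 : nu0 (FreeGroup.of 0) = alpha := by simp [nu0]
    have h1 : nuPsi (FreeGroup.of 0) = alphaPsi := by simp [nuPsi]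
    fin_cases i
    · change inclF (nu0 (FreeGroup.of 0) x) = nuPsi (FreeGroup.of 0) (inclF x)
      rw [h0, h1]
      simp [inclF_x, alphaPsi_z, mul_assoc]
    · change inclF (nu0 (FreeGroup.of 0) y) = nuPsi (FreeGroup.of 0) (inclF y)
      rw [h0, h1]
      simp [inclF_x, inclF_y, alphaPsi_z, mul_assoc, pow_two]
  · have h0 : nu0 (FreeGroup.of 1) = beta := by simp [nu0]
    have h1 : nuPsi (FreeGroup.of 1) = betaPsi := by simp [nuPsi]
    fin_cases i
    · change inclF (nu0 (FreeGroup.of 1) x) = nuPsi (FreeGroup.of 1) (inclF x)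
      rw [h0, h1]
      simp [inclF_x, inclF_y, betaPsi_z, mul_assoc, pow_two]
    · change inclF (nu0 (FreeGroup.of 1) y) = nuPsi (FreeGroup.of 1) (inclF y)
      rw [h0, h1]
      simp [inclF_y, betaPsi_z, mul_assoc]

theorem inclF'_nuF' (r : Phi) (f : FreeGroup (Fin 3)) : inclF' (nuF' r f) = nuPsi r (inclF' f) := by
  refine equivariant_of_generators nuF' nuPsi inclF' (fun a => FreeGroup.ext_hom _ _ fun i => ?_) r f
  fin_cases a
  · fin_cases i <;> simp [nuF', nuPsi, alphaF', inclF', alphaPsi_z, mul_assoc]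
  · fin_cases i <;> simp [nuF', nuPsi, betaF', inclF', betaPsi_z, mul_assoc]

/-- On F′ the automorphism α fixes v and conjugates u and w by (uw)⁻¹, while β fixes u and v and
conjugates w by (vu)⁻¹. Setting v = 1 makes both of them inner. -/
theorem rho_nuF' (r : Phi) (f : FreeGroup (Fin 3)) :
    rho (nuF' r f) = phi r * rho f * (phi r)⁻¹ := by
  refine equivariant_of_generators nuF' (MulAut.conj.comp phi) rho
    (fun a => FreeGroup.ext_hom _ _ fun i => ?_) r f
  fin_cases a
  · fin_cases i <;> simp [nuF', alphaF', rho, phi, mul_assoc]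
  · fin_cases i <;> simp [nuF', betaF', rho, phi, mul_assoc]

/-- Consequently, if conj(g)·ν₀(r) is trivial modulo U, then g commutes with [y,x] modulo U. -/
theorem nu0_commutator (r : Phi) : nu0 r (y * x * y⁻¹ * x⁻¹) = y * x * y⁻¹ * x⁻¹ := by
  have : nu0.range ≤ MulAction.stabilizer (MulAut F) (y * x * y⁻¹ * x⁻¹) := by
    refine nu0_range_le ?_ ?_ <;> rw [MulAction.mem_stabilizer_iff, MulAut.smul_def]
    · simp [pow_two, mul_assoc]
    · simp [pow_two, mul_assoc]
  exact this ⟨r, rfl⟩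

/-- The automorphism `x ↦ x⁻¹`, `y ↦ y⁻¹`, induced by conjugation by `z₂`. -/
def tau : MulAut F := signAut ![-1, -1]

theorem tau_x : tau x = x⁻¹ := by simp [tau, signAut_x]
theorem tau_y : tau y = y⁻¹ := by simp [tau, signAut_y]

theorem inclF_tau (h : F) : inclF (tau h) = z 1 * inclF h * z 1 := by
  have : inclF.comp tau.toMonoidHom = (MulAut.conj (z 1)).toMonoidHom.comp inclF := by
    refine FreeGroup.ext_hom _ _ fun i => ?_
    fin_cases i
    · change inclF (tau x) = z 1 * inclF x * (z 1)⁻¹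
      simp [tau_x, inclF_x, mul_assoc]
    · change inclF (tau y) = z 1 * inclF y * (z 1)⁻¹
      simp [tau_y, inclF_y]
  have h1 := DFunLike.congr_fun this h
  simpa using h1

/-- `ν₀(r)` and conjugation by `z₂` commute up to an inner automorphism of `F`. -/
theorem exists_nuPsi_z_one (r : Phi) : ∃ e : F, nuPsi r (z 1) = inclF e * z 1 ∧
    ∀ h, nu0 r (tau h) = e * tau (nu0 r h) * e⁻¹ := by
  have hom : ∀ (σ : MulAut F) (e : F), σ (tau x) = e * tau (σ x) * e⁻¹ →
      σ (tau y) = e * tau (σ y) * e⁻¹ → ∀ h, σ (tau h) = e * tau (σ h) * e⁻¹ := by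
    intro σ e hx hy h
    have : σ * tau = MulAut.conj e * tau * σ := mulAut_ext hx hy
    exact DFunLike.congr_fun this h
  induction r using FreeGroup.induction_on with
  | C1 => exact ⟨1, by simp⟩
  | of a =>
    fin_cases a
    · refine ⟨(x * x)⁻¹, ?_, ?_⟩
      · simp [nuPsi, alphaPsi_z, inclF_x, mul_assoc]
      · have h0 : nu0 (FreeGroup.of 0) = alpha := by simp [nu0]
        refine hom _ _ ?_ ?_ <;> rw [Fin.zero_eta, h0] <;>
          simp [tau_x, tau_y, pow_two, mul_assoc]
    · refine ⟨(y * y)⁻¹, ?_, ?_⟩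
      · simp [nuPsi, betaPsi_z, inclF_y, mul_assoc]
      · have h0 : nu0 (FreeGroup.of 1) = beta := by simp [nu0]
        refine hom _ _ ?_ ?_ <;> rw [Fin.mk_one, h0] <;>
          simp [tau_x, tau_y, pow_two, mul_assoc]
  | inv_of a ih =>
    obtain ⟨e, h1, h2⟩ := ih
    refine ⟨nu0 (FreeGroup.of a)⁻¹ e⁻¹, ?_, fun h => ?_⟩
    · have hc : ∀ k, nuPsi (FreeGroup.of a) (nuPsi (FreeGroup.of a)⁻¹ k) = k := fun k => by
        rw [← MulAut.mul_apply, ← map_mul, mul_inv_cancel, map_one, MulAut.one_apply]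
      apply (nuPsi (FreeGroup.of a)).injective
      rw [inclF_nu0, map_mul, hc, hc, h1, map_inv, inv_mul_cancel_left]
    · have hc := MulAut.apply_inv_self _ (nu0 (FreeGroup.of a))
      apply (nu0 (FreeGroup.of a)).injective
      rw [map_inv nu0]
      simp only [map_mul, map_inv, hc, h2]
      group
  | mul a b ha hb =>
    obtain ⟨e₁, h1, h2⟩ := ha
    obtain ⟨e₂, h3, h4⟩ := hb
    refine ⟨nu0 a e₂ * e₁, ?_, fun h => ?_⟩
    · rw [map_mul, MulAut.mul_apply, h3, map_mul, h1, map_mul, ← inclF_nu0, mul_assoc]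
    · rw [map_mul, MulAut.mul_apply, h4, map_mul, map_mul, h2, map_inv]
      simp [mul_assoc]

/-! ### `F′` as a subgroup of `Ψ` -/

/-- The automorphism of `F′` induced by conjugation by `zᵢ`. -/
def conjZ (i : Fin 3) : FreeGroup (Fin 3) →* FreeGroup (Fin 3) :=
  FreeGroup.lift (![![.of 1, .of 0, (.of 0 * .of 2 * .of 1)⁻¹],
    ![(.of 1 * .of 0 * .of 2)⁻¹, .of 2, .of 1],
    ![.of 2, (.of 2 * .of 1 * .of 0)⁻¹, .of 0]] i)

theorem inclF'_conjZ (i : Fin 3) (f : FreeGroup (Fin 3)) :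
    inclF' (conjZ i f) = z i * inclF' f * z i := by
  have : inclF'.comp (conjZ i) = (MulAut.conj (z i)).toMonoidHom.comp inclF' := by
    refine FreeGroup.ext_hom _ _ fun j => ?_
    fin_cases i <;> fin_cases j <;> simp [conjZ, inclF', mul_assoc]
  have h1 := DFunLike.congr_fun this f
  simpa using h1

theorem conjZ_conjZ (i : Fin 3) (f : FreeGroup (Fin 3)) : conjZ i (conjZ i f) = f := by
  have : (conjZ i).comp (conjZ i) = MonoidHom.id _ := by
    refine FreeGroup.ext_hom _ _ fun j => ?_
    fin_cases i <;> fin_cases j <;> simp [conjZ, mul_assoc]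
  exact DFunLike.congr_fun this f

/-- The cyclic products z₁z₂z₃, z₂z₃z₁, z₃z₁z₂ are the generators of F′, so composing the three
involutions must give an inner automorphism. -/
theorem conjZ_cyclic (i : Fin 3) (f : FreeGroup (Fin 3)) :
    conjZ i (conjZ (i + 1) (conjZ (i + 2) f)) = .of i * f * (.of i)⁻¹ := by
  have : (conjZ i).comp ((conjZ (i + 1)).comp (conjZ (i + 2))) =
      (MulAut.conj (FreeGroup.of i)).toMonoidHom := by
    refine FreeGroup.ext_hom _ _ fun j => ?_
    fin_cases i <;> fin_cases j <;> simp [conjZ, mul_assoc]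
  exact DFunLike.congr_fun this f

instance inclF'_range_normal : inclF'.range.Normal := by
  rw [← Subgroup.normalizer_eq_top_iff, eq_top_iff, ← psi_closure, Subgroup.closure_le]
  rintro _ ⟨i, rfl⟩
  refine mem_normalizer_of_sq_mem ?_ (by rw [z_mul_self]; exact one_mem _)
  rintro _ ⟨f, rfl⟩
  exact ⟨conjZ i f, by rw [inclF'_conjZ, z_inv]⟩

/-- The permutation by which `zᵢ` acts on `Ψ = F′ · {1, z₁, z₂, z₃}` from the left. -/
def permZ (i : Fin 3) : Equiv.Perm (FreeGroup (Fin 3) × Fin 4) :=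
  let c : Fin 3 → Fin 4 → FreeGroup (Fin 3) :=
    ![![1, 1, .of 0, (.of 1)⁻¹], ![1, (.of 2)⁻¹, 1, .of 1], ![1, .of 2, (.of 0)⁻¹, 1]]
  let s : Fin 3 → Fin 4 → Fin 4 := ![![1, 0, 3, 2], ![2, 3, 0, 1], ![3, 2, 1, 0]]
  Function.Involutive.toPerm (fun k => (conjZ i k.1 * c i k.2, s i k.2)) (by
    rintro ⟨f, k⟩
    have : conjZ i (c i k) * c i (s i k) = 1 := by
      fin_cases i <;> fin_cases k <;> simp [c, s, conjZ]
    refine Prod.ext ?_ ?_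
    · simp only [map_mul, conjZ_conjZ, mul_assoc]
      rw [this, mul_one]
    · fin_cases i <;> fin_cases k <;> rfl)

/-- Through `permZ`, Ψ acts on a model of F′·{1, z₁, z₂, z₃}, and F′ acts on the sheet of index 0 by
left translation, hence faithfully. -/
theorem inclF'_injective : Function.Injective inclF' := by
  let Θ : Psi →* Equiv.Perm (FreeGroup (Fin 3) × Fin 4) := psiLift permZ (by
    intro i
    ext1 k
    exact (permZ i).symm_apply_apply k)
  have hof : ∀ i f, Θ (inclF' (.of i)) (f, 0) = (.of i * f, 0) := by
    intro i f
    have h : conjZ i (conjZ (i + 1) (conjZ (i + 2) f)) * .of i = .of i * f := by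
      rw [conjZ_cyclic, inv_mul_cancel_right]
    fin_cases i
    all_goals
      rw [← h]
      simp [Θ, inclF', permZ]
      simp [conjZ]
  have key : ∀ g f, Θ (inclF' g) (f, 0) = (g * f, 0) := by
    intro g
    induction g using FreeGroup.induction_on with
    | C1 => simp
    | of i => exact hof i
    | inv_of i h =>
      intro f
      rw [map_inv, map_inv, Equiv.Perm.inv_eq_iff_eq, h, mul_inv_cancel_left]
    | mul a b ha hb => intro f; rw [map_mul, map_mul, Equiv.Perm.mul_apply, hb, ha, mul_assoc]
  rw [injective_iff_map_eq_one]
  intro g hg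
  have := key g 1
  rw [hg, map_one] at this
  simpa using (congrArg Prod.fst this).symm

/-! ### The subgroups `F^k[F,F]` -/

/-- The exponent sums modulo `k`. -/
def expSumMod (k : ℕ) : F →* Multiplicative (Fin 2 → ZMod k) :=
  FreeGroup.lift fun i => Multiplicative.ofAdd (Pi.single i 1)

theorem expSumMod_apply (k : ℕ) (w : F) (i : Fin 2) :
    (expSumMod k w).toAdd i = ((expSum w).toAdd i : ZMod k) := by
  induction w using FreeGroup.induction_on with
  | C1 => simp
  | of j => simp [expSumMod, expSum, Pi.single_apply]
  | inv_of j h => simp only [map_inv, toAdd_inv, Pi.neg_apply, h, Int.cast_neg]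
  | mul a b ha hb => simp only [map_mul, toAdd_mul, Pi.add_apply, ha, hb, Int.cast_add]

theorem exists_zpow_mul_zpow {G : Type*} [Group G] (π : F →* G) (h : Commute (π x) (π y)) (w : F) :
    π w = π x ^ ((expSum w).toAdd 0) * π y ^ ((expSum w).toAdd 1) := by
  let φ : Multiplicative (Fin 2 → ℤ) →* G :=
    { toFun := fun v => π x ^ (v.toAdd 0) * π y ^ (v.toAdd 1)
      map_one' := by simp
      map_mul' := fun v w => by
        simp only [toAdd_mul, Pi.add_apply, zpow_add]
        have := (h.zpow_zpow (w.toAdd 0) (v.toAdd 1)).eq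
        simp only [mul_assoc]
        rw [← mul_assoc (π y ^ _) (π x ^ _), ← this]
        simp only [mul_assoc] }
  have : π = φ.comp expSum := by
    refine FreeGroup.ext_hom _ _ fun i => ?_
    fin_cases i
    · simp [φ, expSum, x]
    · simp [φ, expSum, y]
  exact DFunLike.congr_fun this w

/-- Modulo Q the images of x and y commute and have k-th power 1. Containment of F^k[F,F] in a
normal subgroup is thereby reduced to three elements. -/
theorem ker_expSumMod_le (k : ℕ) (Q : Subgroup F) [Q.Normal] (hx : x ^ k ∈ Q) (hy : y ^ k ∈ Q)
    (hc : y * x * y⁻¹ * x⁻¹ ∈ Q) : (expSumMod k).ker ≤ Q := by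
  intro w hw
  let π := QuotientGroup.mk' Q
  have h1 : Commute (π x) (π y) := by
    have : π (y * x * y⁻¹ * x⁻¹) = 1 := (QuotientGroup.eq_one_iff _).2 hc
    simp only [map_mul, map_inv] at this
    rw [mul_inv_eq_one, mul_inv_eq_iff_eq_mul] at this
    exact this.symm
  have hd : ∀ i, (k : ℤ) ∣ (expSum w).toAdd i := fun i => by
    rw [← ZMod.intCast_zmod_eq_zero_iff_dvd, ← expSumMod_apply, MonoidHom.mem_ker.1 hw]
    rfl
  rw [← QuotientGroup.eq_one_iff]
  change π w = 1
  rw [exists_zpow_mul_zpow π h1 w]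
  obtain ⟨a, ha⟩ := hd 0
  obtain ⟨b, hb⟩ := hd 1
  have e1 : π x ^ k = 1 := by rw [← map_pow]; exact (QuotientGroup.eq_one_iff _).2 hx
  have e2 : π y ^ k = 1 := by rw [← map_pow]; exact (QuotientGroup.eq_one_iff _).2 hy
  rw [ha, hb, zpow_mul, zpow_mul, zpow_natCast, zpow_natCast, e1, e2]
  simp

instance powComm_top_normal (k : ℕ) : (powComm k (⊤ : Subgroup F)).Normal := powComm_normal k ⊤

theorem powComm_top_eq_ker (k : ℕ) : powComm k (⊤ : Subgroup F) = (expSumMod k).ker := by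
  apply le_antisymm
  · refine sup_le ?_ ?_
    · rw [Subgroup.closure_le]
      rintro _ ⟨h, -, rfl⟩
      refine MonoidHom.mem_ker.2 ?_
      apply Multiplicative.toAdd.injective
      funext i
      simp
    · rw [Subgroup.commutator_le]
      intro a _ b _
      refine MonoidHom.mem_ker.2 ?_
      rw [map_commutatorElement, commutatorElement_eq_one_iff_mul_comm, mul_comm]
  · exact ker_expSumMod_le k _ (pow_mem_powComm k trivial) (pow_mem_powComm k trivial)
      (commutator_mem_powComm k trivial trivial)

theorem index_powComm_top (k : ℕ) [NeZero k] : (powComm k (⊤ : Subgroup F)).index = k ^ 2 := by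
  have hs : Function.Surjective (expSumMod k) := by
    intro v
    refine ⟨x ^ (v.toAdd 0).val * y ^ (v.toAdd 1).val, ?_⟩
    apply Multiplicative.toAdd.injective
    funext i
    have h0 : expSumMod k x = Multiplicative.ofAdd (Pi.single 0 1) := by simp [expSumMod, x]
    have h1 : expSumMod k y = Multiplicative.ofAdd (Pi.single 1 1) := by simp [expSumMod, y]
    simp only [map_mul, map_pow, h0, h1, toAdd_mul, toAdd_pow, toAdd_ofAdd, Pi.add_apply,
      Pi.smul_apply]
    fin_cases i <;> simp
  rw [powComm_top_eq_ker, Subgroup.index_ker, MonoidHom.range_eq_top.2 hs, Subgroup.card_top]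
  simp

theorem powComm_le_of_dvd {G : Type*} [Group G] {k l : ℕ} (h : k ∣ l) (H : Subgroup G) :
    powComm l H ≤ powComm k H := by
  refine sup_le ?_ le_sup_right
  rw [Subgroup.closure_le]
  rintro _ ⟨g, hg, rfl⟩
  obtain ⟨c, rfl⟩ := h
  change g ^ (k * c) ∈ powComm k H
  rw [mul_comm, pow_mul]
  exact pow_mem_powComm k (pow_mem hg c)

/-! ### Indices -/

theorem relIndex_dvd_relIndex_of_le {G : Type*} [Group G] (N : Subgroup G) [N.Normal]
    {K L : Subgroup G} (h : K ≤ L) : N.relIndex K ∣ N.relIndex L := by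
  rw [← Subgroup.relIndex_subgroupOf h]
  exact Subgroup.relIndex_dvd_index_of_normal _ _

/-- If `M ∩ P` is normal in the normal subgroup `P`, the index of the core of `M` in `P` divides
`[P : M ∩ P]` to the power `[G : P]`. -/
theorem relIndex_normalCore_dvd {G : Type*} [Group G] (P : Subgroup G) [P.Normal] [P.FiniteIndex]
    (M : Subgroup G) [(M.subgroupOf P).Normal] :
    M.normalCore.relIndex P ∣ M.relIndex P ^ P.index := by
  -- One coordinate per coset of P suffices: since M ∩ P is normal in P, the condition ghg⁻¹ ∈ M
  -- depends only on the coset of g.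
  let f : P →* (G ⧸ P → P ⧸ M.subgroupOf P) := MonoidHom.pi fun q =>
    (QuotientGroup.mk' (M.subgroupOf P)).comp (MulAut.conjNormal q.out).toMonoidHom
  have hker : f.ker = M.normalCore.subgroupOf P := by
    ext h
    rw [MonoidHom.mem_ker, Subgroup.mem_subgroupOf, funext_iff]
    have hq : ∀ q : G ⧸ P, f h q = 1 ↔ q.out * h * q.out⁻¹ ∈ M := fun q => by
      change (QuotientGroup.mk' _ (MulAut.conjNormal q.out h)) = 1 ↔ _
      rw [QuotientGroup.mk'_apply, QuotientGroup.eq_one_iff, Subgroup.mem_subgroupOf,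
        MulAut.conjNormal_apply]
    constructor
    · intro H g
      have h1 := (hq (g : G ⧸ P)).1 (H _)
      set r := (g : G ⧸ P).out
      have h2 : g * r⁻¹ ∈ P := by
        have : r⁻¹ * g ∈ P := by
          rw [← QuotientGroup.eq]; exact Quotient.out_eq' _
        have := (inferInstance : P.Normal).conj_mem _ this r
        simpa [mul_assoc] using this
      have h3 : r * h * r⁻¹ ∈ P := (inferInstance : P.Normal).conj_mem _ h.2 r
      have h4 := (inferInstance : (M.subgroupOf P).Normal).conj_mem ⟨_, h3⟩
        (Subgroup.mem_subgroupOf.2 h1) ⟨_, h2⟩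
      rw [Subgroup.mem_subgroupOf] at h4
      have h5 : g * r⁻¹ * (r * h * r⁻¹) * (g * r⁻¹)⁻¹ = g * h * g⁻¹ := by group
      rw [← h5]
      exact h4
    · intro H q
      exact (hq q).2 (H q.out)
  rw [Subgroup.relIndex, ← hker, Subgroup.index_ker]
  have : Nat.card (G ⧸ P → P ⧸ M.subgroupOf P) = M.relIndex P ^ P.index := by
    rw [Nat.card_fun]; rfl
  rw [← this]
  exact Subgroup.card_subgroup_dvd_card _

/-- In Ψ one has x² = uw, y² = vu and [y,x] = v². -/
theorem powComm_two_le_range : powComm 2 (⊤ : Subgroup F) ≤ inclF'.range.comap inclF := by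
  rw [powComm_top_eq_ker]
  refine ker_expSumMod_le 2 _ ⟨.of 0 * .of 2, ?_⟩ ⟨.of 1 * .of 0, ?_⟩ ⟨.of 1 * .of 1, ?_⟩
  all_goals simp [inclF', inclF_x, inclF_y, pow_two, mul_assoc]

theorem exists_lift_powComm_two : ∃ j : powComm 2 (⊤ : Subgroup F) →* FreeGroup (Fin 3),
    ∀ h, inclF' (j h) = inclF h := by
  let e := MonoidHom.ofInjective inclF'_injective
  let k : powComm 2 (⊤ : Subgroup F) →* inclF'.range :=
    (inclF.comp (Subgroup.subtype _)).codRestrict _ fun h => powComm_two_le_range h.2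
  refine ⟨e.symm.toMonoidHom.comp k, fun h => ?_⟩
  exact congrArg Subtype.val (e.apply_symm_apply (k h))

theorem phi_bijective : Function.Bijective phi := by
  let ψ : Fbar →* Phi := FreeGroup.lift ![(.of 1)⁻¹, .of 1 * (.of 0)⁻¹]
  have h1 : ψ.comp phi = MonoidHom.id _ := by
    refine FreeGroup.ext_hom _ _ fun i => ?_
    fin_cases i <;> simp [ψ, phi]
  have h2 : phi.comp ψ = MonoidHom.id _ := by
    refine FreeGroup.ext_hom _ _ fun i => ?_
    fin_cases i <;> simp [ψ, phi]
  exact Function.bijective_iff_has_inverse.2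
    ⟨ψ, fun w => DFunLike.congr_fun h1 w, fun w => DFunLike.congr_fun h2 w⟩

section Index

variable (N : Subgroup (MulAut F))

instance scriptN_normal [N.Normal] : (scriptN N).Normal := inferInstanceAs (N.comap nu0).Normal

instance scriptM_normal [N.Normal] (p : ℕ) : (scriptM N p).Normal := powComm_normal p _

instance map_phi_scriptM_normal [N.Normal] (p : ℕ) : ((scriptM N p).map phi).Normal :=
  (scriptM_normal N p).map phi phi_bijective.2

/-- Because F²[F,F] lies in F′, ρ is defined on it. Normality of M ∩ F²[F,F] and the bound on its
index both follow from this description. -/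
theorem exists_subgroupOf_eq_comap (p : ℕ) :
    ∃ f : powComm 2 (⊤ : Subgroup F) →* Fbar,
      (subgroupM N p).subgroupOf (powComm 2 ⊤) = ((scriptM N p).map phi).comap f := by
  obtain ⟨j, hj⟩ := exists_lift_powComm_two
  refine ⟨rho.comp j, ?_⟩
  ext h
  rw [Subgroup.mem_subgroupOf, subgroupM, Subgroup.mem_comap, ← hj,
    Subgroup.mem_map_iff_mem inclF'_injective]
  rfl

instance subgroupM_subgroupOf_normal [N.Normal] (p : ℕ) :
    ((subgroupM N p).subgroupOf (powComm 2 ⊤)).Normal := by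
  obtain ⟨f, hf⟩ := exists_subgroupOf_eq_comap N p
  rw [hf]
  infer_instance

theorem relIndex_subgroupM_dvd [N.Normal] (p : ℕ) :
    (subgroupM N p).relIndex (powComm 2 ⊤) ∣ (scriptM N p).index := by
  obtain ⟨f, hf⟩ := exists_subgroupOf_eq_comap N p
  rw [Subgroup.relIndex, hf, Subgroup.index_comap]
  exact (Subgroup.relIndex_dvd_index_of_normal _ _).trans
    (Subgroup.index_map_dvd _ phi_bijective.2)

theorem index_scriptN_dvd [N.Normal] : (scriptN N).index ∣ N.relIndex autPrime := by
  rw [scriptN, Subgroup.index_comap]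
  exact relIndex_dvd_relIndex_of_le N nu0_range_le_autPrime

theorem scriptM_le (p : ℕ) : scriptM N p ≤ scriptN N := powComm_le _ _

theorem index_scriptM_dvd [N.Normal] {p n : ℕ} (hp : p.Prime) (hn : n ≠ 0) (hd : (scriptN N).index ∣ n) :
    (scriptM N p).index ∣ n * p ^ (n + 1) := by
  have : (scriptN N).FiniteIndex := ⟨fun h => hn (by simpa [h] using hd)⟩
  rw [← Subgroup.relIndex_mul_index (scriptM_le N p), mul_comm n]
  refine mul_dvd_mul ((relIndex_powComm_dvd hp (scriptN N)).trans ?_) hd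
  exact pow_dvd_pow p (Nat.succ_le_succ (Nat.le_of_dvd (Nat.pos_of_ne_zero hn) hd))

instance subgroupS_normal (p : ℕ) : (subgroupS N p).Normal :=
  Subgroup.normalCore_normal _

instance subgroupT_normal (p : ℕ) : (subgroupT N p).Normal :=
  Subgroup.normal_inf_normal _ _

instance subgroupU_normal (p q : ℕ) : (subgroupU N p q).Normal := powComm_normal q _

theorem subgroupK_normal (p q : ℕ) : (subgroupK N p q).Normal :=
  Subgroup.normal_inf_normal _ _

theorem subgroupT_le (p : ℕ) : subgroupT N p ≤ powComm 2 ⊤ :=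
  inf_le_right.trans (powComm_le_of_dvd (by norm_num) _)

theorem subgroupU_le (p q : ℕ) : subgroupU N p q ≤ subgroupT N p := powComm_le _ _

theorem subgroupK_le (p q : ℕ) : subgroupK N p q ≤ powComm 4 ⊤ := inf_le_right

/-- The factor 36 is 4·9, where 4 = [F : F²[F,F]] and 9 = [F²[F,F] : F⁶[F,F]]; the exponent 4 counts
the cosets in the core estimate. -/
theorem index_subgroupT_dvd [N.Normal] {p m : ℕ} (hm : (scriptM N p).index ∣ m) :
    (subgroupT N p).index ∣ 36 * m ^ 4 := by
  have i2 : (powComm 2 (⊤ : Subgroup F)).index = 4 := index_powComm_top 2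
  have i6 : (powComm 6 (⊤ : Subgroup F)).index = 36 := index_powComm_top 6
  have : (powComm 2 (⊤ : Subgroup F)).FiniteIndex := ⟨by rw [i2]; norm_num⟩
  have hS : (subgroupS N p).relIndex (powComm 2 ⊤) ∣ m ^ 4 := by
    have h1 := relIndex_normalCore_dvd (powComm 2 (⊤ : Subgroup F)) (subgroupM N p)
    rw [i2] at h1
    exact h1.trans (pow_dvd_pow_of_dvd ((relIndex_subgroupM_dvd N p).trans hm) 4)
  have h6 : (powComm 6 (⊤ : Subgroup F)).relIndex (powComm 2 ⊤) = 9 := by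
    have := Subgroup.relIndex_mul_index
      (powComm_le_of_dvd (k := 2) (l := 6) (by norm_num) (⊤ : Subgroup F))
    rw [i2, i6] at this
    omega
  have hT : (subgroupT N p).relIndex (powComm 2 ⊤) ∣ m ^ 4 * 9 := by
    rw [subgroupT, ← Subgroup.relIndex_inf_mul_relIndex, h6]
    exact mul_dvd_mul_right ((relIndex_dvd_relIndex_of_le _ inf_le_right).trans hS) 9
  rw [← Subgroup.relIndex_mul_index (subgroupT_le N p), i2]
  refine (mul_dvd_mul_right hT 4).trans (dvd_of_eq (by ring))

theorem index_subgroupK_dvd [N.Normal] {p q m : ℕ} (hq : q.Prime) (hm0 : m ≠ 0)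
    (hm : (scriptM N p).index ∣ m) :
    (subgroupK N p q).index ∣ 144 * m ^ 4 * q ^ (36 * m ^ 4 + 1) := by
  have hT := index_subgroupT_dvd N hm
  have hpos : 0 < 36 * m ^ 4 := by positivity
  have : (subgroupT N p).FiniteIndex := ⟨fun h => by rw [h, zero_dvd_iff] at hT; omega⟩
  have hU : (subgroupU N p q).index ∣ 36 * m ^ 4 * q ^ (36 * m ^ 4 + 1) := by
    rw [← Subgroup.relIndex_mul_index (subgroupU_le N p q), mul_comm (36 * m ^ 4)]
    refine mul_dvd_mul ((relIndex_powComm_dvd hq (subgroupT N p)).trans ?_) hT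
    exact pow_dvd_pow q (Nat.succ_le_succ (Nat.le_of_dvd hpos hT))
  have i2 : (powComm 2 (⊤ : Subgroup F)).index = 4 := index_powComm_top 2
  have i4 : (powComm 4 (⊤ : Subgroup F)).index = 16 := index_powComm_top 4
  have h24 : powComm 4 (⊤ : Subgroup F) ≤ powComm 2 ⊤ := powComm_le_of_dvd (by norm_num) _
  have h4 : (powComm 4 (⊤ : Subgroup F)).relIndex (powComm 2 ⊤) = 4 := by
    have := Subgroup.relIndex_mul_index h24
    rw [i2, i4] at this
    omega
  -- U already lies in F²[F,F], so intersecting with F⁴[F,F] costs a factor 4 and not 16.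
  have hK : (subgroupK N p q).index ∣ 4 * (subgroupU N p q).index := by
    rw [← Subgroup.relIndex_mul_index ((subgroupK_le N p q).trans h24),
      ← Subgroup.relIndex_mul_index ((subgroupU_le N p q).trans (subgroupT_le N p)), i2,
      show subgroupK N p q = subgroupU N p q ⊓ powComm 4 ⊤ from rfl,
      ← Subgroup.relIndex_inf_mul_relIndex, h4]
    refine (mul_dvd_mul_right (mul_dvd_mul_right
      (relIndex_dvd_relIndex_of_le (subgroupU N p q) inf_le_right) 4) 4).trans
      (dvd_of_eq (by ring))
  exact (hK.trans (mul_dvd_mul_left 4 hU)).trans (dvd_of_eq (by ring))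

end Index

/-! ### The congruence subgroup of `K` -/

section Congruence

variable (N : Subgroup (MulAut F)) (p q : ℕ)

theorem inclF'_of_one : inclF' (.of 1) = inclF (y * x) * z 1 := by
  simp [inclF', inclF_x, inclF_y, mul_assoc]

theorem tau_tau (h : F) : tau (tau h) = h := by
  have : tau * tau = 1 := mulAut_ext (by simp [tau_x]) (by simp [tau_y])
  exact DFunLike.congr_fun this h

/-- τ is conjugation by z₂ = (yx)⁻¹v: the factor yx ∈ F is absorbed by the core, and v ∈ F′
normalizes ρ⁻¹(φ(ℳ)). -/
theorem tau_mem_subgroupS [N.Normal] {h : F} (hh : h ∈ subgroupS N p) : tau h ∈ subgroupS N p := by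
  intro g
  obtain ⟨k, hk, hk'⟩ := hh (y * x * tau g)
  have hn := ((inferInstance : ((scriptM N p).map phi).Normal).comap rho).conj_mem k hk (.of 1)⁻¹
  refine ⟨_, hn, ?_⟩
  rw [map_mul, map_mul, hk', map_inv, map_inv, map_inv, inclF'_of_one]
  simp [inclF_tau, mul_assoc]

theorem tau_mem_subgroupT [N.Normal] {h : F} (hh : h ∈ subgroupT N p) : tau h ∈ subgroupT N p :=
  ⟨tau_mem_subgroupS N p hh.1, powComm_map_le 6 tau.toMonoidHom (fun _ _ => Subgroup.mem_top _) hh.2⟩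

theorem tau_mem_subgroupU [N.Normal] {h : F} (hh : h ∈ subgroupU N p q) : tau h ∈ subgroupU N p q :=
  powComm_map_le q tau.toMonoidHom (fun _ => tau_mem_subgroupT N p) hh

instance map_inclF_subgroupT_normal [N.Normal] : ((subgroupT N p).map inclF).Normal := by
  have h1 : z 1 ∈ Subgroup.normalizer ((subgroupT N p).map inclF : Set Psi) := by
    refine mem_normalizer_of_sq_mem ?_ (by rw [z_mul_self]; exact one_mem _)
    rintro _ ⟨t, ht, rfl⟩
    exact ⟨tau t, tau_mem_subgroupT N p ht, by rw [inclF_tau, z_inv]⟩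
  have hF : ∀ g, inclF g ∈ Subgroup.normalizer ((subgroupT N p).map inclF : Set Psi) := by
    have : ∀ g, ∀ a ∈ (subgroupT N p).map inclF,
        inclF g * a * (inclF g)⁻¹ ∈ (subgroupT N p).map inclF := by
      rintro g _ ⟨t, ht, rfl⟩
      exact ⟨_, (subgroupT_normal N p).conj_mem t ht g, by simp⟩
    intro g
    rw [Subgroup.mem_normalizer_iff]
    refine fun a => ⟨this g a, fun ha => ?_⟩
    have := this g⁻¹ _ ha
    simpa [mul_assoc] using this
  rw [← Subgroup.normalizer_eq_top_iff, eq_top_iff, ← psi_closure, Subgroup.closure_le]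
  rintro _ ⟨i, rfl⟩
  fin_cases i
  · have := mul_mem (hF x) h1
    simpa [inclF_x, mul_assoc] using this
  · exact h1
  · have := mul_mem h1 (hF y)
    simpa [inclF_y, mul_assoc] using this

variable {N p q}

theorem apply_mul_inv_mem {σ : MulAut F} (hσ : σ ∈ congruenceSubgroup (subgroupK N p q)) (h : F) :
    σ h * h⁻¹ ∈ subgroupK N p q := by
  have h1 := inv_mem (QuotientGroup.eq.1 (hσ.2 h))
  have h2 := (subgroupK_normal N p q).conj_mem _ h1 h
  simpa [mul_assoc] using h2

theorem mem_intNu_of_mem_congruenceSubgroup {σ : MulAut F}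
    (hσ : σ ∈ congruenceSubgroup (subgroupK N p q)) : σ ∈ intNu := by
  have h : ∀ i j : Fin 2, (4 : ℤ) ∣ abMatrix σ i j - (1 : Matrix (Fin 2) (Fin 2) ℤ) i j := by
    intro i j
    have h1 : σ (FreeGroup.of j) * (FreeGroup.of j)⁻¹ ∈ (expSumMod 4).ker := by
      rw [← powComm_top_eq_ker]
      exact (apply_mul_inv_mem hσ _).2
    have h2 : (expSumMod 4 (σ (FreeGroup.of j) * (FreeGroup.of j)⁻¹)).toAdd i = 0 := by
      rw [MonoidHom.mem_ker.1 h1]; rfl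
    rw [expSumMod_apply, ZMod.intCast_zmod_eq_zero_iff_dvd] at h2
    rw [map_mul, map_inv, toAdd_mul, toAdd_inv, Pi.add_apply, Pi.neg_apply, ← sub_eq_add_neg] at h2
    have e : (1 : Matrix (Fin 2) (Fin 2) ℤ) i j = (expSum (FreeGroup.of j)).toAdd i := by
      simp [expSum, Matrix.one_apply, Pi.single_apply]
    rw [e]
    exact h2
  refine mem_intNu_of_abMatrix σ ?_ ?_ ?_ ?_
  · simpa using h 0 0
  · simpa using h 1 1
  · simpa using h 0 1
  · simpa using h 1 0

theorem congruenceSubgroup_le [N.Normal] (hp : p.Prime) (hq : q.Prime) (hp2 : Odd p) (hq2 : Odd q)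
    (hInt : intF ≤ N) (hN : (scriptN N).FiniteIndex) (hT : (subgroupT N p).FiniteIndex) :
    congruenceSubgroup (subgroupK N p q) ≤ N := by
  intro σ hσ
  obtain ⟨g, r, rfl⟩ := mem_intNu.1 (mem_intNu_of_mem_congruenceSubgroup hσ)
  suffices hr : r ∈ scriptN N from mul_mem (hInt ⟨g, rfl⟩) hr
  have hK := fun h => apply_mul_inv_mem hσ h
  have happ : ∀ h, (MulAut.conj g * nu0 r) h = g * nu0 r h * g⁻¹ := fun h => rfl
  simp only [happ] at hK
  obtain ⟨e, he, he'⟩ := exists_nuPsi_z_one r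
  -- With σ = conj(g)·ν₀(r), this element d satisfies σ(z₂) = d z₂, that is, σ = conj(d)·τστ on F.
  -- Both σ and τστ are trivial modulo the τ-invariant subgroup U, so d is central modulo U.
  have hd : g * e * (tau g)⁻¹ ∈ subgroupT N p := by
    refine mem_of_central_mod_powComm hq hq2 _ _ fun w => ?_
    let π := QuotientGroup.mk' (subgroupU N p q)
    have h1 : π (g * nu0 r w * g⁻¹) = π w := by
      rw [← mul_inv_eq_one, ← map_inv, ← map_mul]
      exact (QuotientGroup.eq_one_iff _).2 (hK w).1
    have h2 : π (tau (g * nu0 r (tau w) * g⁻¹)) = π w := by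
      have := tau_mem_subgroupU N p q (hK (tau w)).1
      rw [map_mul, map_inv, tau_tau] at this
      rw [← mul_inv_eq_one, ← map_inv, ← map_mul]
      exact (QuotientGroup.eq_one_iff _).2 this
    have h3 : nu0 r w = e * tau (nu0 r (tau w)) * e⁻¹ := by
      rw [← he', tau_tau]
    have h4 : g * nu0 r w * g⁻¹ = g * e * (tau g)⁻¹ *
        tau (g * nu0 r (tau w) * g⁻¹) * (g * e * (tau g)⁻¹)⁻¹ := by
      rw [h3]
      simp only [map_mul, map_inv]
      group
    have h5 : π (g * e * (tau g)⁻¹ * w * (g * e * (tau g)⁻¹)⁻¹ * w⁻¹) = 1 := by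
      rw [map_mul, map_inv π w, mul_inv_eq_one]
      conv_rhs => rw [← h1, h4]
      simp only [map_mul π, map_inv π, h2]
    exact (QuotientGroup.eq_one_iff (N := subgroupU N p q) _).1 h5
  obtain ⟨j, t, ht, hg⟩ := mem_zpowers_of_commute_mod_powComm hq hq2 (subgroupT N p) g (by
    have := (hK (y * x * y⁻¹ * x⁻¹)).1
    rwa [nu0_commutator] at this)
  have hTM : ∀ a ∈ (subgroupT N p).map inclF, ∃ k, rho k ∈ (scriptM N p).map phi ∧
      inclF' k = a := by
    rintro _ ⟨a, ha, rfl⟩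
    exact Subgroup.normalCore_le _ ha.1
  -- The extended σ is trivial modulo T on F and on z₂, and these generate Ψ.
  have hpsi : ∀ w : Psi, inclF g * nuPsi r w * (inclF g)⁻¹ * w⁻¹ ∈ (subgroupT N p).map inclF := by
    let π := QuotientGroup.mk' ((subgroupT N p).map inclF)
    have hF : ∀ h, π (inclF g * nuPsi r (inclF h) * (inclF g)⁻¹) = π (inclF h) := by
      intro h
      rw [← mul_inv_eq_one, ← map_inv π, ← map_mul π]
      refine (QuotientGroup.eq_one_iff _).2 ⟨_, powComm_le q _ (hK h).1, ?_⟩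
      simp [inclF_nu0]
    have hz : π (inclF g * nuPsi r (z 1) * (inclF g)⁻¹) = π (z 1) := by
      rw [← mul_inv_eq_one, ← map_inv π, ← map_mul π]
      refine (QuotientGroup.eq_one_iff _).2 ⟨_, hd, ?_⟩
      rw [he]
      simp [inclF_tau, mul_assoc]
    have hπ : (π.comp (MulAut.conj (inclF g)).toMonoidHom).comp (nuPsi r).toMonoidHom = π := by
      have hmul : ∀ a b, π (inclF g * nuPsi r a * (inclF g)⁻¹) = π a →
          π (inclF g * nuPsi r b * (inclF g)⁻¹) = π b →
          π (inclF g * nuPsi r (a * b) * (inclF g)⁻¹) = π (a * b) := by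
        intro a b ha hb
        rw [map_mul π a b, ← ha, ← hb, ← map_mul π, map_mul (nuPsi r)]
        congr 1
        group
      refine psi_hom_ext fun i => ?_
      change π (inclF g * nuPsi r (z i) * (inclF g)⁻¹) = π (z i)
      fin_cases i
      · have := hmul _ _ (hF x) hz
        simpa [inclF_x, mul_assoc] using this
      · exact hz
      · have := hmul _ _ hz (hF y)
        simpa [inclF_y] using this
    intro w
    rw [← QuotientGroup.eq_one_iff]
    change π _ = 1
    rw [map_mul, map_inv π w, mul_inv_eq_one]
    exact DFunLike.congr_fun hπ w
  obtain ⟨k, ⟨μ, hμ, hμk⟩, hk⟩ := hTM _ ⟨t, ht, rfl⟩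
  -- The lift of g = c^j t to F′, with c = v²; ρ kills the first factor, leaving φ(μ) with μ ∈ ℳ.
  set g' : FreeGroup (Fin 3) := (.of 1 * .of 1) ^ j * k with hg'
  have hgg' : inclF' g' = inclF g := by
    rw [hg, hg', map_mul inclF', map_zpow, hk, map_mul inclF, map_zpow inclF]
    congr 2
    simp [inclF', inclF_x, inclF_y, mul_assoc]
  have hrho : rho g' = phi μ := by
    rw [hg', map_mul, map_zpow, map_mul, hμk]
    simp [rho]
  -- Lift φ(w) to F′, apply `hpsi`, and project back by ρ: the action of σ becomes conjugation by
  -- φ(μr), trivial modulo φ(ℳ).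
  have hcentral : ∀ w, (μ * r) * w * (μ * r)⁻¹ * w⁻¹ ∈ scriptM N p := by
    intro w
    let f : FreeGroup (Fin 3) := FreeGroup.lift ![.of 0, .of 2] (phi w)
    have hf : rho f = phi w := by
      have : rho.comp (FreeGroup.lift ![.of 0, .of 2]) = MonoidHom.id Fbar := by
        refine FreeGroup.ext_hom _ _ fun i => ?_
        fin_cases i <;> simp [rho]
      exact DFunLike.congr_fun this _
    obtain ⟨l, hl, hl'⟩ := hTM _ (hpsi (inclF' f))
    rw [← inclF'_nuF', ← hgg', ← map_inv, ← map_inv, ← map_mul, ← map_mul, ← map_mul] at hl'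
    have := inclF'_injective hl'
    rw [this] at hl
    simp only [map_mul, map_inv, rho_nuF', hrho, hf] at hl
    rw [← Subgroup.mem_map_iff_mem phi_bijective.1]
    simpa [mul_assoc] using hl
  have hμr := mem_of_central_mod_powComm hp hp2 (scriptN N) _ hcentral
  exact (Subgroup.mul_mem_cancel_left _ (powComm_le p _ hμ)).1 hμr

end Congruence

end AutF2

/-- The subgroup `K` constructed explicitly from `N`, `p`, `q` is normal in `F`, its index divides
`144 m⁴ q^(36 m⁴ + 1)`, and `Γ[K] ⊆ N`. -/
theorem theorem5p1 (N : Subgroup (MulAut AutF2.F)) (hnormal : N.Normal)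
    (hfinite : N.FiniteIndex) (hInt : AutF2.intF ≤ N) (hAut : N ≤ AutF2.autPrime)
    (n : ℕ) (hn : n = N.relIndex AutF2.autPrime)
    (p q : ℕ) (hp : p.Prime) (hq : q.Prime) (hp2 : Odd p) (hq2 : Odd q) (hpq : p ≠ q)
    (hpn : ¬ p ∣ n) (hqn : ¬ q ∣ n)
    (m : ℕ) (hm : m = n * p ^ (n + 1)) :
    (AutF2.subgroupK N p q).Normal ∧
      (AutF2.subgroupK N p q).index ∣ 144 * m ^ 4 * q ^ (36 * m ^ 4 + 1) ∧
      AutF2.congruenceSubgroup (AutF2.subgroupK N p q) ≤ N := by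
  have hn0 : n ≠ 0 := by
    rw [hn]
    exact fun h => hfinite.index_ne_zero (Subgroup.index_eq_zero_of_relIndex_eq_zero h)
  have hd : (AutF2.scriptN N).index ∣ n := hn ▸ AutF2.index_scriptN_dvd N
  have hM : (AutF2.scriptM N p).index ∣ m := hm ▸ AutF2.index_scriptM_dvd N hp hn0 hd
  have hm0 : m ≠ 0 := by
    rw [hm]
    exact mul_ne_zero hn0 (pow_ne_zero _ hp.ne_zero)
  refine ⟨AutF2.subgroupK_normal N p q, AutF2.index_subgroupK_dvd N hq hm0 hM,
    AutF2.congruenceSubgroup_le hp hq hp2 hq2 hInt ⟨fun h => ?_⟩ ⟨fun h => ?_⟩⟩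
  · rw [h, zero_dvd_iff] at hd
    exact hn0 hd
  · have hT := AutF2.index_subgroupT_dvd N hM
    rw [h, zero_dvd_iff] at hT
    exact absurd hT (by positivity)
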